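/- Let $A\in\mathbb{R}^{N\times N}$ be any real matrix (a normalized adjacency matrix of a graph with $N$ nodes), $X^{(0)}\in\mathbb{R}^{N\times d_0}$ an input feature matrix, $\sigma_w,\sigma_b\in\mathbb{R}$, and $L\ge1$. Let the activation $\phi:\mathbb{R}\to\mathbb{R}$ be locally Lipschitz and continuously differentiable near every point outside a countable set, with derivative $\dot\phi$ (set to $0$ where $\phi$ is not differentiable). For widths $d_1,\dots,d_{L-1}$ and $d_L=1$, the $L$-layer GCN is $X^{(l)}=\phi(Z^{(l)})$ (entrywise), $Z^{(l)}=\frac{\sigma_w}{\sqrt{d_{l-1}}}AX^{(l-1)}W^{(l)}+\sigma_b\mathbf{1}_{N\times1}b^{(l)}$, with weights $W^{(l)}\in\mathbb{R}^{d_{l-1}\times d_l}$, biases $b^{(l)}\in\mathbb{R}^{1\times d_l}$, and output $f(\theta)=Z^{(L)}\in\mathbb{R}^N$, where $\theta$ collects all weights and biases. Its neural tangent kernel is $\Theta(\theta)=(\nabla_\theta f)(\nabla_\theta f)^T\in\mathbb{R}^{N\times N}$. Define $C^{(0)}=X^{(0)}(X^{(0)})^T/d_0$, $\dot C^{(0)}=\Theta^{(0)}=\mathbf{0}_{N\times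 N}$, and, for $l\ge1$, $$K^{(l)}=\sigma_b^2\mathbf{1}_{N\times N}+\sigma_w^2AC^{(l-1)}A^T,\qquad C^{(l)}=\mathbb{E}_{z\sim\mathcal{N}(0,K^{(l)})}[\phi(z)\phi(z)^T],\qquad \dot C^{(l)}=\mathbb{E}_{z\sim\mathcal{N}(0,K^{(l)})}[\dot\phi(z)\dot\phi(z)^T],$$ $$\Theta^{(l)}=\sigma_b^2\mathbf{1}_{N\times N}+\sigma_w^2A\big(\Theta^{(l-1)}\odot\dot C^{(l-1)}+C^{(l-1)}\big)A^T,$$ where $\odot$ is the entrywise product, and assume that $\phi(z(x))$ and $\dot\phi(z(x))$ have finite second moments for $z\sim\mathcal{N}(0,K^{(l)})$, every node $x$ and every $1\le l\le L-1$. If all weights and biases are independent standard normal, then the neural tangent kernel converges to the deterministic matrix $\Theta^{(L)}$ as the hidden widths $d_1,\dots,d_{L-1}$ tend to infinity in succession: in the sense of weak convergence of laws, the iterated limit $\lim_{d_{L-1}\to\infty}\cdots\lim_{d_1\to\infty}$ of the law of $\Theta(\theta)$, all of whose intermediate limits exist, is the point mass at $\Theta^{(L)}$. (For $L=1$, $\Theta(\theta)=\Theta^{(1)}$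 almost surely.) -/

import Mathlib

open scoped Matrix Topology

/-- The fixed data of a graph convolutional network on the node set `V`: the normalized adjacency
matrix `A` (an arbitrary real matrix, any normalization being allowed), the input features `X`
(with `inDim` features per node), the scales of the weights and of the biases, and the
activation function. -/
structure GCN (V : Type*) where
  A : Matrix V V ℝ
  inDim : ℕ
  X : Matrix V (Fin inDim) ℝ
  σw : ℝ
  σb : ℝ
  φ : ℝ → ℝ

namespace GCN

/-- Names of the scalar parameters, for all layers `l ≥ 1` and all widths at once:
`Sum.inl (l, j, i)` is the weight `W⁽ˡ⁾ⱼᵢ` and `Sum.inr (l, i)` is the bias `b⁽ˡ⁾ᵢ`.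
A network of given finite widths only uses the finitely many names within its widths. -/
abbrev ParamIdx : Type := (ℕ × ℕ × ℕ) ⊕ (ℕ × ℕ)

/-- The name of the weight `W⁽ˡ⁾ⱼᵢ`. -/
abbrev weight (l j i : ℕ) : ParamIdx := Sum.inl (l, j, i)

/-- The name of the bias `b⁽ˡ⁾ᵢ`. -/
abbrev bias (l i : ℕ) : ParamIdx := Sum.inr (l, i)

section network

variable {V : Type*} [Fintype V] (G : GCN V) {k : ℕ} (m : Fin k → ℕ)

/-- The layer widths `d₀, d₁, …, dₖ, dₖ₊₁` of the network with `L = k + 1` layers whose hidden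
widths are `d₁ = m 0, …, dₖ = m (k - 1)`; the last layer has one column, `d_L = 1`. -/
def width : ℕ → ℕ
  | 0 => G.inDim
  | l + 1 => if h : l < k then m ⟨l, h⟩ else 1

/-- The input features, as an array of columns (zero beyond `inDim`; those are never used). -/
def input : V → ℕ → ℝ := fun x j => if h : j < G.inDim then G.X x ⟨j, h⟩ else 0

/-- The affine part of layer `l + 1`, applied to a layer input `h`: column `i` at node `x` is
`∑ v, A x v * y v + σb * b⁽ˡ⁺¹⁾ᵢ` with `y v = σw / √dₗ * ∑ j < dₗ, W⁽ˡ⁺¹⁾ⱼᵢ * h v j`. -/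
noncomputable def affine (θ : ParamIdx → ℝ) (l : ℕ) (h : V → ℕ → ℝ) : V → ℕ → ℝ :=
  fun x i =>
    ∑ v, G.A x v * (G.σw / √(G.width m l : ℝ) *
        ∑ j ∈ Finset.range (G.width m l), θ (weight (l + 1) j i) * h v j)
      + G.σb * θ (bias (l + 1) i)

/-- The post-activations `X⁽ˡ⁾`, with `X⁽⁰⁾` the input. -/
noncomputable def postAct (θ : ParamIdx → ℝ) : ℕ → V → ℕ → ℝ
  | 0 => G.input
  | l + 1 => fun x i => G.φ (G.affine m θ l (postAct θ l) x i)

/-- The scalar output at each node of the network with `L = k + 1` layers: the single column of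
the last pre-activation `Z⁽ᴸ⁾`. -/
noncomputable def output (θ : ParamIdx → ℝ) (x : V) : ℝ :=
  G.affine m θ k (G.postAct m θ k) x 0

/-- The partial derivative of the output at node `x` with respect to the parameter `p`. -/
noncomputable def gradOutput (θ : ParamIdx → ℝ) (p : ParamIdx) (x : V) : ℝ :=
  deriv (fun s : ℝ => G.output m (Function.update θ p s) x) (θ p)

/-- The neural tangent kernel `(∇f)(∇f)ᵀ` of the network with the parameters `θ`: the sum runs
over all weights and biases of the layers `1, …, L = k + 1`. -/
noncomputable def ntk (θ : ParamIdx → ℝ) : V → V → ℝ :=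
  fun x x' =>
    ∑ l ∈ Finset.range (k + 1),
      ((∑ j ∈ Finset.range (G.width m l), ∑ i ∈ Finset.range (G.width m (l + 1)),
          G.gradOutput m θ (weight (l + 1) j i) x * G.gradOutput m θ (weight (l + 1) j i) x')
        + ∑ i ∈ Finset.range (G.width m (l + 1)),
          G.gradOutput m θ (bias (l + 1) i) x * G.gradOutput m θ (bias (l + 1) i) x')

end network

section kernels

variable {V : Type*} [Fintype V] [DecidableEq V]

/-- The Gaussian second moment `𝔼[g(z) g(z)ᵀ]` for `z ∼ 𝒩(0, K)`. -/
noncomputable def secondMoment (g : ℝ → ℝ) (K : Matrix V V ℝ) : Matrix V V ℝ :=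
  Matrix.of fun x x' =>
    ∫ z, g (z x) * g (z x') ∂(ProbabilityTheory.multivariateGaussian (0 : EuclideanSpace ℝ V) K)

variable (G : GCN V)

/-- The transformation `M ↦ σb² 1 + σw² A M Aᵀ`, where `1` is the all-ones matrix. -/
noncomputable def transport (M : Matrix V V ℝ) : Matrix V V ℝ :=
  G.σb ^ 2 • (Matrix.of fun _ _ => 1) + G.σw ^ 2 • (G.A * M * G.Aᵀ)

/-- `C⁽⁰⁾ = X Xᵀ / d₀` and `C⁽ˡ⁾ = 𝔼[φ(z) φ(z)ᵀ]` for `z ∼ 𝒩(0, K⁽ˡ⁾)`, where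
`K⁽ˡ⁾ = σb² 1 + σw² A C⁽ˡ⁻¹⁾ Aᵀ`. -/
noncomputable def C : ℕ → Matrix V V ℝ
  | 0 => (1 / (G.inDim : ℝ)) • (G.X * G.Xᵀ)
  | l + 1 => secondMoment G.φ (G.transport (C l))

/-- The covariance matrix `K⁽ˡ⁾`, for `l ≥ 1` (the value at `0` is never used). -/
noncomputable def K : ℕ → Matrix V V ℝ
  | 0 => 0
  | l + 1 => G.transport (G.C l)

/-- `Ċ⁽⁰⁾ = 0` and `Ċ⁽ˡ⁾ = 𝔼[φ'(z) φ'(z)ᵀ]` for `z ∼ 𝒩(0, K⁽ˡ⁾)`. -/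
noncomputable def dotC : ℕ → Matrix V V ℝ
  | 0 => 0
  | l + 1 => secondMoment (deriv G.φ) (G.K (l + 1))

/-- `Θ⁽⁰⁾ = 0` and `Θ⁽ˡ⁾ = σb² 1 + σw² A (Θ⁽ˡ⁻¹⁾ ⊙ Ċ⁽ˡ⁻¹⁾ + C⁽ˡ⁻¹⁾) Aᵀ`. -/
noncomputable def Theta : ℕ → Matrix V V ℝ
  | 0 => 0
  | l + 1 => G.transport (Theta l ⊙ G.dotC l + G.C l)

end kernels

end GCN

/-- The limit in succession `lim_{dₖ → ∞} ⋯ lim_{d₂ → ∞} lim_{d₁ → ∞} F (d₁, …, dₖ) = a`: the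
innermost limit is the one in the first index, and each of the intermediate limits exists. -/
def SeqTendsto {X : Type*} [TopologicalSpace X] : (k : ℕ) → ((Fin k → ℕ) → X) → X → Prop
  | 0, F, a => F ![] = a
  | k + 1, F, a => ∃ F' : (Fin k → ℕ) → X,
      (∀ m : Fin k → ℕ,
        Filter.Tendsto (fun d : ℕ => F (Fin.cons d m)) Filter.atTop (𝓝 (F' m))) ∧
      SeqTendsto k F' a

/-!
At finite width, condition on everything below a layer: the columns of its pre-activations are
independent, and each of them is Gaussian, with covariance `transport Ĉ`, where `Ĉ` is the
empirical second moment of the layer input (`GCN.map_column_colLaw`). As the width of the layer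
below grows, `Ĉ` converges almost surely to its Gaussian counterpart by the law of large numbers
(`GCN.ae_tendsto_empiricalMoment`), so finitely many columns converge in law to independent
Gaussian columns. Sending the first hidden width to infinity therefore leads to a network of the
same kind with one hidden layer less, whose first pre-activations have the covariance of the next
layer in place of that of the input layer.

The tangent kernel propagates alongside. Let `M i i'` be the matrix of inner products of the
gradients of the columns `i` and `i'` of the pre-activations of a layer, with respect to all
parameters up to that layer. By the chain rule, the kernel of the next layer is an explicit function
of `M`, of the pre-activations and of the weights (`GCN.nextTangent`). When `M` is deterministic and
diagonal in `i, i'`, the law of large numbers gives again a deterministic diagonal limit, with the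
recursion `Θ ↦ transport (Θ ⊙ Ċ + C)` (`GCN.ae_tendsto_nextTangent`); off the diagonal, products of
independent weights average to `0`. The law of the kernel of the output is thus a function of `n`,
the number of hidden layers left, of the covariance `K` and of the diagonal kernel `Θ`
(`GCN.tangentLaw`), and the limit in one width lowers `n` by one (`GCN.tendsto_tangentLaw`).

Two points need care. The derivative of the activation may be discontinuous, so that weak
convergence of the columns does not pass to the tangent kernel of the layers above. But the
convergence is setwise: Gaussian measures whose covariances converge converge against all bounded
measurable functions, by convergence of the densities, provided that the degenerate directions of
the limit are degenerate along the sequence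
(`ProbabilityTheory.exists_kernel_tendsto_integral_pi_multivariateGaussian`), and here they are
(`GCN.ae_transport_empiricalMoment_mulVec_eq_zero`). Under setwise convergence the random Lipschitz
constant of the output kernel as a function of `M` stays bounded in probability, which allows `M` to
be replaced by its limit (`GCN.tendstoInMeasure_outputTangent_sub`).

The other point is that the chain rule may fail for parameters that put a pre-activation at a point
where the activation is not differentiable. As a function of a single parameter, a pre-activation
that takes such a value does so, off a countable set of values of the parameter, with derivative
`0`, and there the chain rule survives because the activation is locally Lipschitz. So the chain
rule holds almost surely (`GCN.ae_gradOutput_eq`).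
-/

open MeasureTheory ProbabilityTheory Filter

/-! ### Setwise convergence of Gaussian measures -/

namespace ProbabilityTheory

variable {ι : Type*} [Fintype ι]

/-- The density of the standard Gaussian measure on `ι → ℝ`. -/
noncomputable def stdDensity (y : ι → ℝ) : ℝ := ∏ i, gaussianPDFReal 0 1 (y i)

lemma stdDensity_eq (y : ι → ℝ) :
    stdDensity y = (√(2 * Real.pi))⁻¹ ^ Fintype.card ι * Real.exp (-(∑ i, y i ^ 2) / 2) := by
  simp [stdDensity, gaussianPDFReal, Finset.prod_mul_distrib, ← Real.exp_sum, neg_div,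
    Finset.sum_div]

lemma stdDensity_nonneg (y : ι → ℝ) : 0 ≤ stdDensity y :=
  Finset.prod_nonneg fun _ _ => gaussianPDFReal_nonneg _ _ _

lemma continuous_stdDensity : Continuous (stdDensity (ι := ι)) := by
  rw [funext stdDensity_eq]; fun_prop

lemma integrable_stdDensity : Integrable (stdDensity (ι := ι)) :=
  Integrable.fintype_prod fun _ => integrable_gaussianPDFReal 0 1

lemma pi_gaussianReal_eq_withDensity :
    Measure.pi (fun _ : ι => gaussianReal 0 1)
      = (volume : Measure (ι → ℝ)).withDensity fun y => ENNReal.ofReal (stdDensity y) := by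
  refine Measure.pi_eq fun s hs => ?_
  have hbox : MeasurableSet (Set.univ.pi s) := .univ_pi hs
  have hind (y : ι → ℝ) : (Set.univ.pi s).indicator (stdDensity (ι := ι)) y
      = ∏ i, (s i).indicator (gaussianPDFReal 0 1) (y i) := by
    by_cases hy : y ∈ Set.univ.pi s
    · rw [Set.indicator_of_mem hy]
      exact Finset.prod_congr rfl fun i _ => (Set.indicator_of_mem (hy i trivial) _).symm
    · rw [Set.indicator_of_notMem hy]
      obtain ⟨i, hi⟩ : ∃ i, y i ∉ s i := by simpa [Set.mem_pi] using hy
      exact (Finset.prod_eq_zero (Finset.mem_univ i) (Set.indicator_of_notMem hi _)).symm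
  rw [withDensity_apply _ hbox, ← lintegral_indicator hbox]
  have h1 : (Set.univ.pi s).indicator (fun y : ι → ℝ => ENNReal.ofReal (stdDensity y))
      = fun y => ENNReal.ofReal ((Set.univ.pi s).indicator (stdDensity (ι := ι)) y) := by
    ext y; by_cases hy : y ∈ Set.univ.pi s
    · simp only [Set.indicator_of_mem hy]
    · simp only [Set.indicator_of_notMem hy, ENNReal.ofReal_zero]
  rw [h1, ← ofReal_integral_eq_lintegral_ofReal (integrable_stdDensity.indicator hbox)
    (ae_of_all _ fun y => Set.indicator_nonneg (fun y _ => stdDensity_nonneg y) y)]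
  simp_rw [hind]
  rw [integral_fintype_prod_volume_eq_prod (fun i => (s i).indicator (gaussianPDFReal 0 1)),
    ENNReal.ofReal_prod_of_nonneg fun i _ => integral_nonneg fun y =>
      Set.indicator_nonneg (fun y _ => gaussianPDFReal_nonneg 0 1 y) y]
  refine Finset.prod_congr rfl fun i _ => ?_
  rw [integral_indicator (hs i), gaussianReal_apply_eq_integral _ one_ne_zero]

lemma integral_pi_gaussianReal (g : (ι → ℝ) → ℝ) :
    ∫ y, g y ∂(Measure.pi fun _ : ι => gaussianReal 0 1) = ∫ y, stdDensity y * g y := by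
  rw [pi_gaussianReal_eq_withDensity, integral_withDensity_eq_integral_toReal_smul
    continuous_stdDensity.measurable.ennreal_ofReal (ae_of_all _ fun _ => ENNReal.ofReal_lt_top)]
  simp [ENNReal.toReal_ofReal (stdDensity_nonneg _)]

lemma sum_sq_mulVec_le (T : Matrix ι ι ℝ) (u : ι → ℝ) :
    ∑ i, (T *ᵥ u) i ^ 2 ≤ (∑ i, ∑ j, T i j ^ 2) * ∑ j, u j ^ 2 := by
  rw [Finset.sum_mul]
  exact Finset.sum_le_sum fun i _ => Finset.sum_mul_sq_le_sq_mul_sq _ _ _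

variable [DecidableEq ι]

/-- The change of variables `y = T u` in a standard Gaussian integral. -/
lemma integral_mulVec_pi_gaussianReal {T : Matrix ι ι ℝ} (hT : T.det ≠ 0) (g : (ι → ℝ) → ℝ)
    (hg : Measurable g) :
    ∫ y, g (T *ᵥ y) ∂(Measure.pi fun _ : ι => gaussianReal 0 1)
      = ∫ y, |(T.det)⁻¹| * (stdDensity (T⁻¹ *ᵥ y) * g y) := by
  have hmeas : Measurable (Matrix.toLin' T) :=
    (Matrix.toLin' T).continuous_of_finiteDimensional.measurable
  have hmeas' : Measurable fun y : ι → ℝ => T⁻¹ *ᵥ y :=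
    (Continuous.matrix_mulVec continuous_const continuous_id).measurable
  have hcv := Real.map_matrix_volume_pi_eq_smul_volume_pi hT
  have h2 : ∫ y, stdDensity (T⁻¹ *ᵥ y) * g y ∂((volume : Measure (ι → ℝ)).map (Matrix.toLin' T))
      = ∫ y, stdDensity y * g (T *ᵥ y) := by
    have hm : Measurable fun y => stdDensity (T⁻¹ *ᵥ y) * g y :=
      (continuous_stdDensity.measurable.comp hmeas').mul hg
    rw [integral_map hmeas.aemeasurable hm.aestronglyMeasurable]
    simp [Matrix.toLin'_apply, Matrix.mulVec_mulVec,
      Matrix.nonsing_inv_mul _ (isUnit_iff_ne_zero.2 hT)]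
  rw [integral_pi_gaussianReal, ← h2, hcv, integral_smul_measure, integral_const_mul,
    ENNReal.toReal_ofReal (abs_nonneg _), smul_eq_mul]

/-- Standard Gaussian measures distorted by linear maps that tend to the identity converge
setwise, and not only weakly: their densities converge pointwise and stay below a fixed
Gaussian. -/
theorem tendsto_integral_mulVec_pi_gaussianReal {T : ℕ → Matrix ι ι ℝ}
    (hT : Tendsto T atTop (𝓝 1)) {g : (ι → ℝ) → ℝ} (hg : Measurable g) {c : ℝ}
    (hc : ∀ y, |g y| ≤ c) :
    Tendsto (fun n => ∫ y, g (T n *ᵥ y) ∂(Measure.pi fun _ : ι => gaussianReal 0 1)) atTop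
      (𝓝 (∫ y, g y ∂(Measure.pi fun _ : ι => gaussianReal 0 1))) := by
  have hdet : Tendsto (fun n => (T n).det) atTop (𝓝 1) := by
    simpa [Function.comp_def] using ((continuous_id.matrix_det).tendsto (1 : Matrix ι ι ℝ)).comp hT
  have hne : ∀ᶠ n in atTop, (T n).det ≠ 0 := hdet.eventually_ne one_ne_zero
  have hinv : Tendsto (fun n => |((T n).det)⁻¹|) atTop (𝓝 1) := by
    simpa using (hdet.inv₀ one_ne_zero).abs
  have hTinv : Tendsto (fun n => (T n)⁻¹) atTop (𝓝 1) := by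
    have h : Tendsto (fun n => ((T n).det)⁻¹ • (T n).adjugate) atTop
        (𝓝 ((1 : ℝ)⁻¹ • (1 : Matrix ι ι ℝ).adjugate)) :=
      (hdet.inv₀ one_ne_zero).smul
        (((continuous_id.matrix_adjugate).tendsto (1 : Matrix ι ι ℝ)).comp hT)
    simpa [Matrix.inv_def, Ring.inverse_eq_inv'] using h
  set b : ℝ := (∑ i, ∑ j, (1 : Matrix ι ι ℝ) i j ^ 2) + 1 with hb
  have hb0 : 0 < b := by positivity
  have hfro : Tendsto (fun n => ∑ i, ∑ j, T n i j ^ 2) atTop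
      (𝓝 (∑ i, ∑ j, (1 : Matrix ι ι ℝ) i j ^ 2)) :=
    tendsto_finsetSum _ fun i _ => tendsto_finsetSum _ fun j _ =>
      (((continuous_id.matrix_elem i j).tendsto (1 : Matrix ι ι ℝ)).comp hT).pow 2
  have hfro' : ∀ᶠ n in atTop, ∑ i, ∑ j, T n i j ^ 2 < b :=
    hfro.eventually_lt_const (by simp [hb])
  have hinv' : ∀ᶠ n in atTop, |((T n).det)⁻¹| < 2 := hinv.eventually_lt_const one_lt_two
  have hlim : Tendsto (fun n => ∫ y, |((T n).det)⁻¹| * (stdDensity ((T n)⁻¹ *ᵥ y) * g y)) atTop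
      (𝓝 (∫ y, stdDensity y * g y)) := by
    refine tendsto_integral_filter_of_dominated_convergence
      (fun y => 2 * ((√(2 * Real.pi))⁻¹ ^ Fintype.card ι
        * (∏ i, Real.exp (-(1 / (2 * b)) * y i ^ 2)) * c)) ?_ ?_ ?_ ?_
    · refine Eventually.of_forall fun n => Measurable.aestronglyMeasurable ?_
      have : Measurable fun y : ι → ℝ => (T n)⁻¹ *ᵥ y :=
        (Continuous.matrix_mulVec continuous_const continuous_id).measurable
      exact ((continuous_stdDensity.measurable.comp this).mul hg).const_mul _
    · filter_upwards [hne, hfro', hinv'] with n h1 h2 h3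
      refine ae_of_all _ fun y => ?_
      have hy : ∑ i, y i ^ 2 ≤ b * ∑ i, ((T n)⁻¹ *ᵥ y) i ^ 2 := by
        have := sum_sq_mulVec_le (T n) ((T n)⁻¹ *ᵥ y)
        rw [Matrix.mulVec_mulVec, Matrix.mul_nonsing_inv _ (isUnit_iff_ne_zero.2 h1),
          Matrix.one_mulVec] at this
        exact this.trans (mul_le_mul_of_nonneg_right h2.le
          (Finset.sum_nonneg fun i _ => sq_nonneg _))
      have hexp : stdDensity ((T n)⁻¹ *ᵥ y) ≤ (√(2 * Real.pi))⁻¹ ^ Fintype.card ι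
          * (∏ i, Real.exp (-(1 / (2 * b)) * y i ^ 2)) := by
        rw [stdDensity_eq, ← Real.exp_sum, ← Finset.mul_sum]
        gcongr
        rw [show -(1 / (2 * b)) * ∑ i, y i ^ 2 = -((∑ i, y i ^ 2) / b) / 2 by field_simp]
        have := (div_le_iff₀' hb0).2 hy
        linarith
      rw [Real.norm_eq_abs, abs_mul, abs_mul, abs_abs, abs_of_nonneg (stdDensity_nonneg _)]
      exact mul_le_mul h3.le (mul_le_mul hexp (hc y) (abs_nonneg _)
        ((stdDensity_nonneg _).trans hexp))
        (mul_nonneg (stdDensity_nonneg _) (abs_nonneg _)) zero_le_two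
    · refine Integrable.const_mul (Integrable.mul_const (Integrable.const_mul ?_ _) _) _
      exact Integrable.fintype_prod (f := fun _ x => Real.exp (-(1 / (2 * b)) * x ^ 2))
        fun _ => integrable_exp_neg_mul_sq (by positivity)
    · refine ae_of_all _ fun y => ?_
      have h1 : Tendsto (fun n => (T n)⁻¹ *ᵥ y) atTop (𝓝 y) := by
        have := ((Continuous.matrix_mulVec continuous_id
          (continuous_const (y := y))).tendsto (1 : Matrix ι ι ℝ)).comp hTinv
        simpa [Function.comp_def] using this
      simpa using hinv.mul (((continuous_stdDensity.tendsto y).comp h1).mul_const (g y))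
  rw [integral_pi_gaussianReal]
  refine hlim.congr' ?_
  filter_upwards [hne] with n hn
  rw [integral_mulVec_pi_gaussianReal hn g hg]

open WithLp in
/-- The law of a linear image of a standard Gaussian vector. -/
lemma map_stdGaussian_toEuclideanCLM (B : Matrix ι ι ℝ) :
    (stdGaussian (EuclideanSpace ℝ ι)).map (Matrix.toEuclideanCLM (𝕜 := ℝ) B)
      = multivariateGaussian 0 (B * Bᵀ) := by
  have hB : (B * Bᵀ).PosSemidef := by
    simpa using Matrix.posSemidef_self_mul_conjTranspose B
  apply Measure.ext_of_charFun
  ext t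
  have hinner (x : EuclideanSpace ℝ ι) : inner ℝ (Matrix.toEuclideanCLM (𝕜 := ℝ) B x) t
      = inner ℝ x (Matrix.toEuclideanCLM (𝕜 := ℝ) Bᵀ t) := by
    simp only [EuclideanSpace.inner_eq_star_dotProduct, Matrix.ofLp_toEuclideanCLM, star_trivial]
    rw [dotProduct_comm, Matrix.mulVec_transpose, ← Matrix.dotProduct_mulVec, dotProduct_comm]
  rw [charFun_multivariateGaussian hB, charFun_apply, integral_map (by fun_prop) (by fun_prop)]
  simp_rw [hinner]
  rw [← charFun_apply, charFun_stdGaussian, ← Complex.ofReal_pow, EuclideanSpace.real_norm_sq_eq]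
  have : ∑ i, (Matrix.toEuclideanCLM (𝕜 := ℝ) Bᵀ t) i ^ 2 = t.ofLp ⬝ᵥ (B * Bᵀ) *ᵥ t.ofLp := by
    rw [← Matrix.mulVec_mulVec, Matrix.dotProduct_mulVec, ← Matrix.mulVec_transpose]
    simp [dotProduct, Matrix.ofLp_toEuclideanCLM, pow_two]
  rw [this]
  simp [neg_div]

open scoped MatrixOrder in
/-- A positive semidefinite matrix `K` has a symmetric square root `R` with a symmetric
pseudo-inverse `P`, so that `Q = R P` is the orthogonal projection onto the range of `K`. -/
lemma exists_sqrt_pseudoInverse {K : Matrix ι ι ℝ} (hK : K.PosSemidef) :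
    ∃ R P Q : Matrix ι ι ℝ, Rᵀ = R ∧ Pᵀ = P ∧ Qᵀ = Q ∧ Q * Q = Q ∧ R * P = Q ∧ P * R = Q ∧
      R * R = K ∧ R * Q = R := by
  have hsa : IsSelfAdjoint K := hK.isHermitian
  have hcont (f : ℝ → ℝ) : ContinuousOn f (spectrum ℝ K) :=
    (Matrix.finite_real_spectrum (A := K)).continuousOn f
  have hsym (f : ℝ → ℝ) : (cfc f K)ᵀ = cfc f K := by
    have : IsSelfAdjoint (cfc f K) := cfc_predicate f K
    simpa [Matrix.star_eq_conjTranspose] using this.star_eq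
  have hmul (f g : ℝ → ℝ) : cfc f K * cfc g K = cfc (fun x => f x * g x) K :=
    (cfc_mul f g K (hcont f) (hcont g)).symm
  have hinv (x : ℝ) : √x * (√x)⁻¹ * √x = √x := mul_inv_mul_cancel _
  refine ⟨cfc (fun x => √x) K, cfc (fun x => (√x)⁻¹) K, cfc (fun x => √x * (√x)⁻¹) K,
    hsym _, hsym _, hsym _, ?_, hmul _ _, ?_, ?_, ?_⟩
  · rw [hmul]; congr 1; ext x; rw [← mul_assoc, hinv]
  · rw [hmul]; congr 1; ext x; rw [mul_comm]
  · rw [hmul]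
    conv_rhs => rw [← cfc_id ℝ K]
    refine cfc_congr fun x hx => ?_
    have : 0 ≤ x := by
      obtain ⟨i, rfl⟩ := hK.isHermitian.spectrum_real_eq_range_eigenvalues ▸ hx
      exact hK.eigenvalues_nonneg i
    exact Real.mul_self_sqrt this
  · rw [hmul]; congr 1; ext x; rw [mul_comm, hinv]

/-- Independent copies of a centred Gaussian vector, as the image of one standard Gaussian
vector. -/
lemma pi_multivariateGaussian_eq_map (κ : Type*) [Fintype κ] (B : Matrix ι ι ℝ) :
    Measure.pi (fun _ : κ => multivariateGaussian 0 (B * Bᵀ))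
      = (Measure.pi fun _ : κ × ι => gaussianReal 0 1).map
          fun y i => WithLp.toLp 2 (B *ᵥ fun v => y (i, v)) := by
  have hm : Measurable fun y : ι → ℝ => WithLp.toLp 2 (B *ᵥ y) :=
    (PiLp.continuous_toLp 2 _).measurable.comp
      (Continuous.matrix_mulVec continuous_const continuous_id).measurable
  have h1 : multivariateGaussian 0 (B * Bᵀ)
      = (Measure.pi fun _ : ι => gaussianReal 0 1).map fun y => WithLp.toLp 2 (B *ᵥ y) := by
    rw [← map_stdGaussian_toEuclideanCLM, ← map_pi_eq_stdGaussian,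
      Measure.map_map (by fun_prop) (by fun_prop)]
    congr 1
  have h2 := Measure.infinitePi_map_curry (ι := κ) (κ := ι) (X := ℝ) (fun _ _ => gaussianReal 0 1)
  rw [Measure.infinitePi_eq_pi, Measure.infinitePi_eq_pi] at h2
  simp_rw [Measure.infinitePi_eq_pi] at h2
  have : IsProbabilityMeasure
      ((Measure.pi fun _ : ι => gaussianReal 0 1).map fun y => WithLp.toLp 2 (B *ᵥ y)) :=
    Measure.isProbabilityMeasure_map hm.aemeasurable
  have hm' : Measurable fun (x : κ → ι → ℝ) i => WithLp.toLp 2 (B *ᵥ x i) :=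
    measurable_pi_lambda _ fun i => hm.comp (measurable_pi_apply i)
  simp_rw [h1]
  rw [← Measure.pi_map_pi fun _ => hm.aemeasurable, ← h2,
    Measure.map_map hm' (MeasurableEquiv.measurable _)]
  rfl

open scoped MatrixOrder Matrix.Norms.L2Operator in
/-- Centred Gaussian measures whose covariances tend to `K` converge setwise to the one of
covariance `K`, if they have no more directions of degeneracy than `K` has; these directions
are spanned by the columns of the matrix `N`. -/
theorem exists_kernel_tendsto_integral_pi_multivariateGaussian {K : Matrix ι ι ℝ}
    (hK : K.PosSemidef) :
    ∃ N : Matrix ι ι ℝ, K * N = 0 ∧ ∀ (κ : Type) [Fintype κ] (S : ℕ → Matrix ι ι ℝ),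
      (∀ n, (S n).PosSemidef) → Tendsto S atTop (𝓝 K) → (∀ n, S n * N = 0) →
      ∀ (g : (κ → EuclideanSpace ℝ ι) → ℝ) (c : ℝ), Measurable g → (∀ z, |g z| ≤ c) →
        Tendsto (fun n => ∫ z, g z ∂(Measure.pi fun _ : κ => multivariateGaussian 0 (S n))) atTop
          (𝓝 (∫ z, g z ∂(Measure.pi fun _ : κ => multivariateGaussian 0 K))) := by
  classical
  obtain ⟨R, P, Q, hR, hP, hQ, hQQ, hRP, hPR, hRR, hRQ⟩ := exists_sqrt_pseudoInverse hK
  -- the columns of `1 - Q` span the kernel of `K`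
  refine ⟨1 - Q, ?_, ?_⟩
  · rw [← hRR, Matrix.mul_assoc, mul_sub, hRQ, mul_one, sub_self, mul_zero]
  intro κ _ S hS hSK hSN g c hg hc
  have hSQ (n : ℕ) : S n * Q = S n := by
    have := hSN n
    rw [mul_sub, mul_one, sub_eq_zero] at this
    exact this.symm
  have hSt (n : ℕ) : (S n)ᵀ = S n := by simpa [Matrix.IsHermitian] using (hS n).isHermitian
  have hQS (n : ℕ) : Q * S n = S n := by
    have := congrArg Matrix.transpose (hSQ n)
    rwa [Matrix.transpose_mul, hQ, hSt] at this
  have hpsd (n : ℕ) : (P * S n * P + (1 - Q)).PosSemidef := by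
    refine Matrix.PosSemidef.add ?_ ?_
    · have := (hS n).mul_mul_conjTranspose_same P
      simpa [hP] using this
    · have := Matrix.posSemidef_self_mul_conjTranspose (1 - Q)
      have h : (1 - Q) * (1 - Q) = 1 - Q := by
        rw [mul_sub, sub_mul, sub_mul, hQQ]; simp
      simpa [hQ, h] using this
  -- `S n = (R T) (R T)ᵀ` for a matrix `T` that tends to `1`; the summand `1 - Q` makes the limit
  -- invertible and is annihilated by `R`
  set T : ℕ → Matrix ι ι ℝ := fun n => CFC.sqrt (P * S n * P + (1 - Q)) with hT
  have hTT (n : ℕ) : T n * T n = P * S n * P + (1 - Q) :=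
    CFC.sqrt_mul_sqrt_self _ (hpsd n).nonneg
  have hTt (n : ℕ) : (T n)ᵀ = T n := by
    have : IsSelfAdjoint (T n) := (CFC.sqrt_nonneg _).isSelfAdjoint
    simpa [Matrix.star_eq_conjTranspose] using this.star_eq
  have hlim : Tendsto (fun n => P * S n * P + (1 - Q)) atTop (𝓝 1) := by
    have h : Tendsto (fun n => P * S n * P + (1 - Q)) atTop (𝓝 (P * K * P + (1 - Q))) :=
      ((hSK.const_mul P).mul_const P).add_const _
    have h1 : P * K * P = Q := by
      rw [← hRR, ← Matrix.mul_assoc, hPR, Matrix.mul_assoc, hRP, hQQ]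
    rwa [h1, add_sub_cancel] at h
  have hTlim : Tendsto T atTop (𝓝 1) := by
    have h := (CFC.continuousOn_sqrt (A := Matrix ι ι ℝ)).continuousWithinAt
      (x := 1) (by simp [Matrix.PosSemidef.one.nonneg])
    have := h.tendsto.comp (tendsto_nhdsWithin_iff.2
      ⟨hlim, Eventually.of_forall fun n => (hpsd n).nonneg⟩)
    simpa [Function.comp_def] using this
  have hS_eq (n : ℕ) : S n = (R * T n) * (R * T n)ᵀ := by
    rw [Matrix.transpose_mul, hR, hTt, ← Matrix.mul_assoc, Matrix.mul_assoc R, hTT,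
      Matrix.mul_add, Matrix.add_mul, mul_sub, hRQ, mul_one, sub_self, Matrix.zero_mul, add_zero,
      ← Matrix.mul_assoc, ← Matrix.mul_assoc, hRP, hQS, Matrix.mul_assoc, hPR, hSQ]
  have hK_eq : K = R * Rᵀ := by rw [hR, hRR]
  set F : (κ × ι → ℝ) → κ → EuclideanSpace ℝ ι :=
    fun y i => WithLp.toLp 2 (R *ᵥ fun v => y (i, v)) with hF
  have hmeas (B : Matrix ι ι ℝ) : Measurable fun (y : κ × ι → ℝ) (i : κ) =>
      WithLp.toLp 2 (B *ᵥ fun v => y (i, v)) := by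
    refine measurable_pi_lambda _ fun i => (PiLp.continuous_toLp 2 _).measurable.comp ?_
    exact (Continuous.matrix_mulVec continuous_const (by fun_prop)).measurable
  -- the copies are distorted by `T n` independently, hence jointly by a block diagonal matrix
  have hkron : Tendsto (fun n => Matrix.kroneckerMap (· * ·) (1 : Matrix κ κ ℝ) (T n)) atTop
      (𝓝 1) := by
    rw [← Matrix.one_kronecker_one (α := ℝ) (m := κ) (n := ι)]
    refine tendsto_pi_nhds.2 fun i => tendsto_pi_nhds.2 fun j => ?_
    simp only [Matrix.kroneckerMap_apply]
    exact (((continuous_id.matrix_elem i.2 j.2).tendsto _).comp hTlim).const_mul _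
  have key := tendsto_integral_mulVec_pi_gaussianReal hkron (hg.comp (hmeas R)) (c := c)
    fun y => hc _
  have hKint : ∫ z, g z ∂(Measure.pi fun _ : κ => multivariateGaussian 0 K)
      = ∫ y, (g ∘ F) y ∂(Measure.pi fun _ : κ × ι => gaussianReal 0 1) := by
    rw [hK_eq, pi_multivariateGaussian_eq_map,
      integral_map (hmeas R).aemeasurable hg.aestronglyMeasurable]
    rfl
  rw [hKint]
  refine key.congr fun n => ?_
  rw [hS_eq n, pi_multivariateGaussian_eq_map,
    integral_map (hmeas _).aemeasurable hg.aestronglyMeasurable]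
  refine integral_congr_ae (ae_of_all _ fun y => ?_)
  simp only [Function.comp_apply]
  congr 1
  ext i v
  simp only [← Matrix.mulVec_mulVec]
  congr 2
  ext v
  simp [Matrix.mulVec, dotProduct, Fintype.sum_prod_type, Matrix.one_apply]

end ProbabilityTheory

/-! ### The gradient of the network -/

/-- The points of a level set of `h` at which `h` has a nonzero derivative are isolated in the level
set, hence countably many. -/
lemma countable_setOf_eq_and_hasDerivAt_ne_zero (h : ℝ → ℝ) (c : ℝ) :
    {s | h s = c ∧ ∃ h', h' ≠ 0 ∧ HasDerivAt h h' s}.Countable := by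
  set S := {s | h s = c ∧ ∃ h', h' ≠ 0 ∧ HasDerivAt h h' s} with hS
  have : DiscreteTopology S := by
    rw [discreteTopology_subtype_iff]
    rintro s ⟨-, h', hne, hd⟩
    rw [← disjoint_iff, Filter.disjoint_principal_right]
    filter_upwards [hd.eventually_ne (c := c) hne] with t ht hts using ht hts.1
  exact Set.countable_coe_iff.1 (countable_of_Lindelof_of_discrete (X := S))

/-- A locally Lipschitz function composed with a function of zero derivative has zero derivative,
whether or not the outer function is differentiable. -/
lemma LocallyLipschitz.hasDerivAt_comp_zero {φ : ℝ → ℝ} (hφ : LocallyLipschitz φ) {h : ℝ → ℝ}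
    {s : ℝ} (hh : HasDerivAt h 0 s) : HasDerivAt (fun t => φ (h t)) 0 s := by
  obtain ⟨K, U, hU, hK⟩ := hφ (h s)
  rw [hasDerivAt_iff_isLittleO] at hh ⊢
  simp only [smul_zero, sub_zero] at hh ⊢
  refine Asymptotics.IsBigO.trans_isLittleO (Asymptotics.IsBigO.of_bound K ?_) hh
  have hcont : ContinuousAt h s := by
    have : HasDerivAt h 0 s := by rw [hasDerivAt_iff_isLittleO]; simpa using hh
    exact this.continuousAt
  filter_upwards [hcont.preimage_mem_nhds hU] with t ht
  simpa [dist_eq_norm] using hK.dist_le_mul _ ht _ (mem_of_mem_nhds hU)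

/-- The chain rule off a countable set, for an outer function that is locally Lipschitz and
differentiable off a countable set. -/
lemma exists_countable_hasDerivAt_comp {φ : ℝ → ℝ} (hφ : LocallyLipschitz φ)
    (hφ' : {t : ℝ | ¬ ContDiffAt ℝ 1 φ t}.Countable) {h h' : ℝ → ℝ} {N : Set ℝ}
    (hN : N.Countable) (hh : ∀ s ∉ N, HasDerivAt h (h' s) s) :
    ∃ N' : Set ℝ, N'.Countable ∧
      ∀ s ∉ N', HasDerivAt (fun t => φ (h t)) (deriv φ (h s) * h' s) s := by
  refine ⟨N ∪ ⋃ c ∈ {t : ℝ | ¬ ContDiffAt ℝ 1 φ t},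
    {s | h s = c ∧ ∃ h', h' ≠ 0 ∧ HasDerivAt h h' s},
    hN.union (hφ'.biUnion fun c _ => countable_setOf_eq_and_hasDerivAt_ne_zero h c), ?_⟩
  intro s hs
  simp only [Set.mem_union, Set.mem_iUnion, not_or, not_exists] at hs
  have hd := hh s hs.1
  by_cases hc : ContDiffAt ℝ 1 φ (h s)
  · exact (hc.differentiableAt one_ne_zero).hasDerivAt.comp s hd
  · have h0 : h' s = 0 := by
      by_contra h0
      exact hs.2 (h s) hc ⟨rfl, h' s, h0, hd⟩
    rw [h0] at hd ⊢
    rw [mul_zero]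
    exact hφ.hasDerivAt_comp_zero hd

namespace MeasureTheory.Measure

variable {ι : Type*} [DecidableEq ι] {X : ι → Type*} [∀ i, MeasurableSpace (X i)]

lemma measurable_update_prod (p : ι) :
    Measurable fun q : (∀ i, X i) × X p => Function.update q.1 p q.2 := by
  refine measurable_pi_lambda _ fun i => ?_
  by_cases hi : i = p
  · subst hi; simpa using measurable_snd
  · simpa [Function.update_of_ne hi, Function.comp_def] using
      (measurable_pi_apply i).comp measurable_fst

/-- Resampling one coordinate does not change a product measure. -/
lemma map_update_infinitePi (μ : (i : ι) → Measure (X i)) [∀ i, IsProbabilityMeasure (μ i)]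
    (p : ι) :
    ((infinitePi μ).prod (μ p)).map (fun q => Function.update q.1 p q.2) = infinitePi μ := by
  refine eq_infinitePi _ fun s t ht => ?_
  rw [map_apply (measurable_update_prod p) (MeasurableSet.pi s.countable_toSet fun i _ => ht i)]
  by_cases hp : p ∈ s
  · have : (fun q : (∀ i, X i) × X p => Function.update q.1 p q.2) ⁻¹' Set.pi s t
        = Set.pi (s.erase p) t ×ˢ t p := by
      ext ⟨x, a⟩
      simp only [Set.mem_preimage, Set.mem_pi, Set.mem_prod, Finset.mem_coe, Finset.mem_erase]
      constructor
      · intro h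
        exact ⟨fun i hi => by simpa [Function.update_of_ne hi.1] using h i hi.2,
          by simpa using h p hp⟩
      · rintro ⟨h1, h2⟩ i hi
        by_cases hip : i = p
        · subst hip; simpa using h2
        · simpa [Function.update_of_ne hip] using h1 i ⟨hip, hi⟩
    rw [this, prod_prod, infinitePi_pi _ fun i _ => ht i, mul_comm,
      Finset.mul_prod_erase _ (fun i => μ i (t i)) hp]
  · have : (fun q : (∀ i, X i) × X p => Function.update q.1 p q.2) ⁻¹' Set.pi s t
        = Set.pi s t ×ˢ Set.univ := by
      ext ⟨x, a⟩
      simp only [Set.mem_preimage, Set.mem_pi, Set.mem_prod, Finset.mem_coe, Set.mem_univ, and_true]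
      refine forall₂_congr fun i hi => ?_
      rw [Function.update_of_ne (ne_of_mem_of_not_mem hi hp)]
    rw [this, prod_prod, infinitePi_pi _ fun i _ => ht i, measure_univ, mul_one]

/-- A property that, along one atomless coordinate, fails for countably many values only holds
almost surely. -/
lemma ae_infinitePi_of_countable_update {μ : (i : ι) → Measure (X i)}
    [∀ i, IsProbabilityMeasure (μ i)] (p : ι) [NullSingletonClass (μ p)] {P : (∀ i, X i) → Prop}
    (hP : MeasurableSet {x | P x}) (h : ∀ x, {a | ¬ P (Function.update x p a)}.Countable) :
    ∀ᵐ x ∂(infinitePi μ), P x := by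
  rw [← map_update_infinitePi μ p, ae_map_iff (measurable_update_prod p).aemeasurable hP,
    Measure.ae_prod_iff_ae_ae (p := fun q => P (Function.update q.1 p q.2))
      (measurable_update_prod p hP)]
  exact ae_of_all _ fun x => (h x).measure_zero _

end MeasureTheory.Measure

namespace GCN

section

variable {V : Type*} [Fintype V] (G : GCN V) {k : ℕ} (m : Fin k → ℕ)

/-- The derivative of `affine` with respect to the parameter `p`, when the layer input `h` has the
derivative `dh`. -/
noncomputable def affineGrad (θ : ParamIdx → ℝ) (p : ParamIdx) (l : ℕ) (h dh : V → ℕ → ℝ) :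
    V → ℕ → ℝ :=
  fun x i =>
    ∑ v, G.A x v * (G.σw / √(G.width m l : ℝ) *
        ∑ j ∈ Finset.range (G.width m l),
          ((if p = weight (l + 1) j i then h v j else 0) + θ (weight (l + 1) j i) * dh v j))
      + G.σb * if p = bias (l + 1) i then 1 else 0

/-- The derivative of the post-activations with respect to the parameter `p`, as the chain rule
gives it. -/
noncomputable def postGrad (θ : ParamIdx → ℝ) (p : ParamIdx) : ℕ → V → ℕ → ℝ
  | 0 => 0
  | l + 1 => fun x i => deriv G.φ (G.affine m θ l (G.postAct m θ l) x i) *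
      G.affineGrad m θ p l (G.postAct m θ l) (postGrad θ p l) x i

lemma hasDerivAt_affine (θ : ParamIdx → ℝ) (p : ParamIdx) (l : ℕ) {h dh : ℝ → V → ℕ → ℝ} {s : ℝ}
    (hh : ∀ v j, HasDerivAt (fun s => h s v j) (dh s v j) s) (x : V) (i : ℕ) :
    HasDerivAt (fun s => G.affine m (Function.update θ p s) l (h s) x i)
      (G.affineGrad m (Function.update θ p s) p l (h s) (dh s) x i) s := by
  have hup (q : ParamIdx) : HasDerivAt (fun s => Function.update θ p s q)
      (if p = q then 1 else 0) s := by
    by_cases hq : p = q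
    · subst hq; simpa using hasDerivAt_id' s
    · simpa [Function.update_of_ne (Ne.symm hq), hq] using hasDerivAt_const s (θ q)
  unfold affine affineGrad
  refine HasDerivAt.add (HasDerivAt.fun_sum fun v _ => HasDerivAt.const_mul _
    (HasDerivAt.const_mul _ (HasDerivAt.fun_sum fun j _ => ?_))) (HasDerivAt.const_mul _ (hup _))
  have := (hup (weight (l + 1) j i)).mul (hh v j)
  convert! this using 1
  simp only [ite_mul, one_mul, zero_mul]

variable {G}

/-- As functions of a single parameter, the post-activations obey the chain rule off a countable
set of its values. -/
lemma exists_countable_hasDerivAt_postAct (hφ : LocallyLipschitz G.φ)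
    (hφ' : {t : ℝ | ¬ ContDiffAt ℝ 1 G.φ t}.Countable) (θ : ParamIdx → ℝ) (p : ParamIdx) (l : ℕ) :
    ∃ N : Set ℝ, N.Countable ∧ ∀ s ∉ N, ∀ x i,
      HasDerivAt (fun s => G.postAct m (Function.update θ p s) l x i)
        (G.postGrad m (Function.update θ p s) p l x i) s := by
  induction l with
  | zero => exact ⟨∅, Set.countable_empty, fun s _ x i => hasDerivAt_const s _⟩
  | succ l ih =>
    obtain ⟨N, hN, hd⟩ := ih
    have h1 (x : V) (i : ℕ) := exists_countable_hasDerivAt_comp hφ hφ' hN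
      fun s hs => G.hasDerivAt_affine m θ p l
        (h := fun s => G.postAct m (Function.update θ p s) l)
        (dh := fun s => G.postGrad m (Function.update θ p s) p l) (hd s hs) x i
    choose N' hN' hd' using h1
    refine ⟨⋃ x, ⋃ i, N' x i, Set.countable_iUnion fun x => Set.countable_iUnion fun i => hN' x i,
      fun s hs x i => ?_⟩
    simp only [Set.mem_iUnion, not_exists] at hs
    exact hd' x i s (hs x i)

lemma continuous_postAct (hφ : Continuous G.φ) (l : ℕ) (x : V) (i : ℕ) :
    Continuous fun θ : ParamIdx → ℝ => G.postAct m θ l x i := by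
  induction l generalizing x i with
  | zero => exact continuous_const
  | succ l ih => simp only [postAct, affine]; fun_prop

lemma continuous_output (hφ : Continuous G.φ) (x : V) :
    Continuous fun θ : ParamIdx → ℝ => G.output m θ x := by
  have := continuous_postAct m hφ k
  simp only [output, affine]; fun_prop

lemma measurable_deriv_apply {ι : Type*} [Countable ι] {f : (ι → ℝ) → ℝ → ℝ}
    (hf : Continuous f.uncurry) (p : ι) : Measurable fun θ : ι → ℝ => deriv (f θ) (θ p) := by
  have h : Measurable fun q : (ι → ℝ) × ℝ => deriv (f q.1) q.2 := measurable_deriv_with_param hf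
  have h' : Measurable fun θ : ι → ℝ => (θ, θ p) := measurable_id.prodMk (measurable_pi_apply p)
  exact h.comp h'

lemma measurable_gradOutput (hφ : Continuous G.φ) (p : ParamIdx) (x : V) :
    Measurable fun θ : ParamIdx → ℝ => G.gradOutput m θ p x :=
  measurable_deriv_apply (f := fun θ s => G.output m (Function.update θ p s) x)
    ((continuous_output m hφ x).comp (continuous_fst.update p continuous_snd)) p

lemma measurable_ntk (hφ : Continuous G.φ) :
    Measurable fun θ : ParamIdx → ℝ => G.ntk m θ := by
  have h (p : ParamIdx) (x x' : V) :
      Measurable fun θ : ParamIdx → ℝ => G.gradOutput m θ p x * G.gradOutput m θ p x' :=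
    (measurable_gradOutput m hφ p x).mul (measurable_gradOutput m hφ p x')
  refine measurable_pi_lambda _ fun x => measurable_pi_lambda _ fun x' => ?_
  simp only [ntk]
  apply Finset.measurable_fun_sum
  intro l _
  apply Measurable.add
  · exact Finset.measurable_fun_sum _ fun j _ => Finset.measurable_fun_sum _ fun i _ =>
      h (weight (l + 1) j i) x x'
  · exact Finset.measurable_fun_sum _ fun i _ => h (bias (l + 1) i) x x'

lemma measurable_postGrad (hφ : Continuous G.φ) (p : ParamIdx) (l : ℕ) (x : V) (i : ℕ) :
    Measurable fun θ : ParamIdx → ℝ => G.postGrad m θ p l x i := by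
  induction l generalizing x i with
  | zero => exact measurable_const
  | succ l ih =>
    have h1 (x : V) (i : ℕ) := (continuous_postAct m hφ l x i).measurable
    have h2 := measurable_deriv G.φ
    simp only [postGrad, affineGrad, affine]
    refine Measurable.mul (h2.comp (by fun_prop)) ?_
    refine Measurable.add (Finset.measurable_fun_sum _ fun v _ => Measurable.const_mul
      (Measurable.const_mul (Finset.measurable_fun_sum _ fun j _ => ?_) _) _) measurable_const
    split_ifs <;> fun_prop

/-- Almost surely, the gradient of the output is given by the chain rule, in spite of the points
where the activation is not differentiable. -/
lemma ae_gradOutput_eq (hφ : LocallyLipschitz G.φ)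
    (hφ' : {t : ℝ | ¬ ContDiffAt ℝ 1 G.φ t}.Countable) :
    ∀ᵐ θ ∂(Measure.infinitePi fun _ : ParamIdx => gaussianReal 0 1), ∀ p x,
      G.gradOutput m θ p x
        = G.affineGrad m θ p k (G.postAct m θ k) (G.postGrad m θ p k) x 0 := by
  rw [ae_all_iff]; intro p
  rw [ae_all_iff]; intro x
  have : NullSingletonClass (gaussianReal 0 1) := nullSingletonClass_gaussianReal one_ne_zero
  refine Measure.ae_infinitePi_of_countable_update p ?_ fun θ => ?_
  · refine measurableSet_eq_fun (measurable_gradOutput m hφ.continuous p x) ?_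
    have h1 (x : V) (i : ℕ) := (continuous_postAct m hφ.continuous k x i).measurable
    have h2 := measurable_postGrad m hφ.continuous p k
    simp only [affineGrad]
    refine Measurable.add (Finset.measurable_fun_sum _ fun v _ => Measurable.const_mul
      (Measurable.const_mul (Finset.measurable_fun_sum _ fun j _ => ?_) _) _) measurable_const
    split_ifs <;> fun_prop
  · obtain ⟨N, hN, hd⟩ := exists_countable_hasDerivAt_postAct m hφ hφ' θ p k
    refine hN.mono fun s hs => by_contra fun hsN => hs ?_
    have := (G.hasDerivAt_affine m θ p k
      (h := fun s => G.postAct m (Function.update θ p s) k)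
      (dh := fun s => G.postGrad m (Function.update θ p s) p k) (hd s hsN) x 0).deriv
    simpa [gradOutput, output] using this

end

end GCN

/-! ### Laws of large numbers -/

namespace ProbabilityTheory

section pairs

variable {α β γ δ : Type*} [MeasurableSpace α] [MeasurableSpace β] [MeasurableSpace γ]
  [MeasurableSpace δ]

lemma measurePreserving_prodProdProdComm (a : Measure α) (b : Measure β) (c : Measure γ)
    (d : Measure δ) [IsProbabilityMeasure a] [IsProbabilityMeasure b] [IsProbabilityMeasure c]
    [IsProbabilityMeasure d] :
    MeasurePreserving (fun q : (α × β) × (γ × δ) => ((q.1.1, q.2.1), (q.1.2, q.2.2)))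
      ((a.prod b).prod (c.prod d)) ((a.prod c).prod (b.prod d)) := by
  have e1 := measurePreserving_prodAssoc a b (c.prod d)
  have e2 := (MeasurePreserving.id a).prod ((measurePreserving_prodAssoc b c d).symm)
  have e3 := (MeasurePreserving.id a).prod
    ((Measure.measurePreserving_swap (μ := b) (ν := c)).prod (MeasurePreserving.id d))
  have e4 := (MeasurePreserving.id a).prod (measurePreserving_prodAssoc c b d)
  have e5 := (measurePreserving_prodAssoc a c (b.prod d)).symm
  exact e5.comp (e4.comp (e3.comp (e2.comp e1)))

variable {A B : Type*} [MeasurableSpace A] [MeasurableSpace B] {μ : Measure A} {ν : Measure B}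
  [IsProbabilityMeasure μ] [IsProbabilityMeasure ν]

/-- On a product space, pairs formed from independent variables on the two factors are
independent. -/
lemma IndepFun.prodMk_prod {Y : A → α} {Y' : A → β} {U : B → γ} {U' : B → δ}
    (hY : IndepFun Y Y' μ) (hU : IndepFun U U' ν) (mY : Measurable Y) (mY' : Measurable Y')
    (mU : Measurable U) (mU' : Measurable U') :
    IndepFun (fun q : A × B => (Y q.1, U q.2)) (fun q => (Y' q.1, U' q.2)) (μ.prod ν) := by
  have := Measure.isProbabilityMeasure_map (μ := μ) mY.aemeasurable
  have := Measure.isProbabilityMeasure_map (μ := μ) mY'.aemeasurable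
  have := Measure.isProbabilityMeasure_map (μ := ν) mU.aemeasurable
  have := Measure.isProbabilityMeasure_map (μ := ν) mU'.aemeasurable
  rw [indepFun_iff_map_prod_eq_prod_map_map (by fun_prop) (by fun_prop)]
  have h1 : (μ.prod ν).map (fun q : A × B => (Y q.1, U q.2)) = (μ.map Y).prod (ν.map U) :=
    (Measure.map_prod_map μ ν mY mU).symm
  have h2 : (μ.prod ν).map (fun q : A × B => (Y' q.1, U' q.2)) = (μ.map Y').prod (ν.map U') :=
    (Measure.map_prod_map μ ν mY' mU').symm
  rw [h1, h2, ← (measurePreserving_prodProdProdComm (μ.map Y) (μ.map Y') (ν.map U)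
    (ν.map U')).map_eq, ← (indepFun_iff_map_prod_eq_prod_map_map mY.aemeasurable
    mY'.aemeasurable).1 hY, ← (indepFun_iff_map_prod_eq_prod_map_map mU.aemeasurable
    mU'.aemeasurable).1 hU, Measure.map_prod_map _ _ (mY.prodMk mY') (mU.prodMk mU'),
    Measure.map_map (by fun_prop) (by fun_prop)]
  rfl

/-- The strong law of large numbers for products `Yⱼ Uⱼ`, where the `Yⱼ` and the `Uⱼ` live on the
two factors of a product space. -/
lemma strong_law_ae_mul_prod {Y : ℕ → A → ℝ} {U : ℕ → B → ℝ} (mY : ∀ j, Measurable (Y j))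
    (mU : ∀ j, Measurable (U j)) (iY : Integrable (Y 0) μ) (iU : Integrable (U 0) ν)
    (hY : Pairwise fun j j' => IndepFun (Y j) (Y j') μ)
    (hU : Pairwise fun j j' => IndepFun (U j) (U j') ν)
    (lY : ∀ j, μ.map (Y j) = μ.map (Y 0)) (lU : ∀ j, ν.map (U j) = ν.map (U 0)) :
    ∀ᵐ q ∂(μ.prod ν), Tendsto (fun d : ℕ => (∑ j ∈ Finset.range d, Y j q.1 * U j q.2) / d) atTop
      (𝓝 ((∫ a, Y 0 a ∂μ) * ∫ b, U 0 b ∂ν)) := by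
  have hmul : Measurable fun p : ℝ × ℝ => p.1 * p.2 := measurable_fst.mul measurable_snd
  have hind : Pairwise (Function.onFun (fun f g => IndepFun f g (μ.prod ν))
      fun j (q : A × B) => Y j q.1 * U j q.2) := fun j j' hj =>
    ((hY hj).prodMk_prod (hU hj) (mY j) (mY j') (mU j) (mU j')).comp hmul hmul
  have hid (j : ℕ) : IdentDistrib (fun q : A × B => Y j q.1 * U j q.2)
      (fun q => Y 0 q.1 * U 0 q.2) (μ.prod ν) (μ.prod ν) := by
    have h : IdentDistrib (fun q : A × B => (Y j q.1, U j q.2)) (fun q => (Y 0 q.1, U 0 q.2))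
        (μ.prod ν) (μ.prod ν) := by
      have m (j : ℕ) : Measurable fun q : A × B => (Y j q.1, U j q.2) :=
        ((mY j).comp measurable_fst).prodMk ((mU j).comp measurable_snd)
      refine ⟨(m j).aemeasurable, (m 0).aemeasurable, ?_⟩
      have := Measure.map_prod_map μ ν (mY j) (mU j)
      rw [lY, lU, Measure.map_prod_map μ ν (mY 0) (mU 0)] at this
      exact this.symm
    exact h.comp hmul
  have hlim := strong_law_ae_real (μ := μ.prod ν) (fun j q => Y j q.1 * U j q.2)
    (iY.mul_prod iU) hind hid
  rwa [integral_prod_mul] at hlim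

lemma map_comp_eval_infinitePi (μ : Measure A) [IsProbabilityMeasure μ] {ψ : A → α}
    (mψ : Measurable ψ) (j : ℕ) :
    (Measure.infinitePi fun _ : ℕ => μ).map (fun z => ψ (z j)) = μ.map ψ := by
  have h := (measurePreserving_eval_infinitePi (fun _ : ℕ => μ) j).map_eq
  calc _ = ((Measure.infinitePi fun _ : ℕ => μ).map (Function.eval j)).map ψ := by
        rw [Measure.map_map mψ (measurable_pi_apply j)]; rfl
    _ = _ := by rw [h]

lemma integral_comp_eval_infinitePi (μ : Measure A) [IsProbabilityMeasure μ] {ψ : A → ℝ}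
    (mψ : Measurable ψ) (j : ℕ) :
    ∫ z, ψ (z j) ∂(Measure.infinitePi fun _ : ℕ => μ) = ∫ a, ψ a ∂μ := by
  have m1 : AEMeasurable (fun z : ℕ → A => ψ (z j)) (Measure.infinitePi fun _ : ℕ => μ) :=
    (mψ.comp (measurable_pi_apply j)).aemeasurable
  have h1 := integral_map m1 (f := fun x : ℝ => x) aestronglyMeasurable_id
  have h2 := integral_map (μ := μ) mψ.aemeasurable (f := fun x : ℝ => x) aestronglyMeasurable_id
  rw [← h1, ← h2, map_comp_eval_infinitePi μ mψ j]

/-- The strong law of large numbers on a product space. -/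
lemma strong_law_ae_infinitePi (μ : Measure A) [IsProbabilityMeasure μ] {ψ : A → ℝ}
    (mψ : Measurable ψ) (iψ : Integrable ψ μ) :
    ∀ᵐ z ∂(Measure.infinitePi fun _ : ℕ => μ),
      Tendsto (fun d : ℕ => (∑ j ∈ Finset.range d, ψ (z j)) / d) atTop (𝓝 (∫ a, ψ a ∂μ)) := by
  have hmp := measurePreserving_eval_infinitePi fun _ : ℕ => μ
  have h := strong_law_ae_real (μ := Measure.infinitePi fun _ : ℕ => μ) (fun j z => ψ (z j))
    ((hmp 0).integrable_comp_of_integrable iψ)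
    (fun j j' hj => (iIndepFun_infinitePi (fun _ => mψ)).indepFun hj)
    fun j => ⟨(mψ.comp (measurable_pi_apply j)).aemeasurable,
      (mψ.comp (measurable_pi_apply 0)).aemeasurable, by
        rw [map_comp_eval_infinitePi μ mψ, map_comp_eval_infinitePi μ mψ]⟩
  rwa [integral_comp_eval_infinitePi μ mψ] at h

end pairs

end ProbabilityTheory

namespace GCN

/-- The law of the parameters that enter one column of a layer: `none` names the bias and `some j`
the weight with row index `j`. -/
noncomputable def colLaw : Measure (Option ℕ → ℝ) := Measure.infinitePi fun _ => gaussianReal 0 1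

instance : IsProbabilityMeasure colLaw := by unfold colLaw; infer_instance

/-- The law of the parameters of one layer; its columns are independent. -/
noncomputable def layerLaw : Measure (ℕ → Option ℕ → ℝ) := Measure.infinitePi fun _ => colLaw

instance : IsProbabilityMeasure layerLaw := by unfold layerLaw; infer_instance

lemma charFun_colLaw_sum (F : Finset (Option ℕ)) (a : Option ℕ → ℝ) :
    ∫ c, Complex.exp ((∑ o ∈ F, a o * c o : ℝ) * Complex.I) ∂colLaw
      = Complex.exp (-((∑ o ∈ F, a o ^ 2 : ℝ) : ℂ) / 2) := by
  have hX : iIndepFun (fun (o : Option ℕ) (c : Option ℕ → ℝ) => a o * c o) colLaw :=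
    iIndepFun_infinitePi (X := fun o x => a o * x) fun o => measurable_id.const_mul (a o)
  have h := congrFun (iIndepFun.charFun_map_fun_finsetSum_eq_prod (P := colLaw) (s := F)
    (X := fun o c => a o * c o) (fun o _ => ((measurable_pi_apply o).const_mul _).aemeasurable)
    (hX.precomp (g := fun o : F => (o : Option ℕ)) Subtype.val_injective)) 1
  rw [charFun_apply_real, integral_map (Measurable.aemeasurable (by fun_prop)) (by fun_prop)] at h
  have h1 (o : Option ℕ) : charFun (colLaw.map fun c => a o * c o) 1
      = Complex.exp (-((a o ^ 2 : ℝ) : ℂ) / 2) := by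
    have : colLaw.map (fun c => a o * c o) = (gaussianReal 0 1).map (a o * ·) := by
      rw [← Measure.infinitePi_map_eval (fun _ : Option ℕ => gaussianReal 0 1) o,
        Measure.map_map (by fun_prop) (by fun_prop)]
      rfl
    rw [this, charFun_map_mul, charFun_gaussianReal]
    simp [neg_div]
  rw [Finset.prod_apply] at h
  simp_rw [h1, ← Complex.exp_sum] at h
  simpa [Finset.sum_neg_distrib, Finset.sum_div, neg_div] using h

lemma map_layerLaw_eval_pair {i i' : ℕ} (hi : i ≠ i') (j : ℕ) :
    layerLaw.map (fun W => (W i (some j), W i' (some j)))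
      = (gaussianReal 0 1).prod (gaussianReal 0 1) := by
  have h1 : layerLaw.map (fun W => (W i, W i')) = colLaw.prod colLaw :=
    Measure.infinitePi_map_eval_prod hi
  have h2 : colLaw.map (fun c => c (some j)) = gaussianReal 0 1 :=
    Measure.infinitePi_map_eval (fun _ : Option ℕ => gaussianReal 0 1) (some j)
  conv_rhs => rw [← h2, Measure.map_prod_map _ _ (by fun_prop) (by fun_prop), ← h1,
    Measure.map_map (by fun_prop) (by fun_prop)]
  rfl

lemma map_layerLaw_eval (i : ℕ) (o : Option ℕ) :
    layerLaw.map (fun W => W i o) = gaussianReal 0 1 := by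
  have h1 : layerLaw.map (fun W => W i) = colLaw :=
    Measure.infinitePi_map_eval (fun _ : ℕ => colLaw) i
  rw [← Measure.infinitePi_map_eval (fun _ : Option ℕ => gaussianReal 0 1) o]
  change _ = Measure.map _ colLaw
  rw [← h1, Measure.map_map (by fun_prop) (by fun_prop)]
  rfl

lemma iIndepFun_layerLaw :
    iIndepFun (fun (p : ℕ × Option ℕ) (W : ℕ → Option ℕ → ℝ) => W p.1 p.2) layerLaw :=
  iIndepFun_uncurry_infinitePi' (X := fun _ _ x => x)
    (fun (_ : ℕ) (_ : Option ℕ) => gaussianReal 0 1) fun _ _ => measurable_id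

lemma integrable_sq_gaussianReal : Integrable (fun x : ℝ => x * x) (gaussianReal 0 1) := by
  have := (memLp_id_gaussianReal (μ := 0) (v := 1) 2).integrable_sq
  simpa [pow_two] using this

lemma integral_sq_gaussianReal : ∫ x : ℝ, x * x ∂(gaussianReal 0 1) = 1 := by
  have h := variance_id_gaussianReal (μ := 0) (v := 1)
  rw [variance_eq_sub (memLp_id_gaussianReal (μ := 0) (v := 1) 2)] at h
  simpa [pow_two] using h

variable {A : Type*} [MeasurableSpace A]

/-- The strong law of large numbers for the products of two weights out of the same row, times an
independent factor. -/
lemma strong_law_ae_weights (μ : Measure A) [IsProbabilityMeasure μ] {ψ : A → ℝ}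
    (mψ : Measurable ψ) (iψ : Integrable ψ μ) (i i' : ℕ) :
    ∀ᵐ q ∂((Measure.infinitePi fun _ : ℕ => μ).prod layerLaw), Tendsto (fun d : ℕ =>
      (∑ j ∈ Finset.range d, ψ (q.1 j) * (q.2 i (some j) * q.2 i' (some j))) / d) atTop
      (𝓝 ((∫ a, ψ a ∂μ) * if i = i' then 1 else 0)) := by
  have hmp := measurePreserving_eval_infinitePi fun _ : ℕ => μ
  have hlaw := map_comp_eval_infinitePi μ mψ
  have h0 := integral_comp_eval_infinitePi μ mψ 0
  have key (iU : Integrable (fun W : ℕ → Option ℕ → ℝ => W i (some 0) * W i' (some 0)) layerLaw)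
      (hU : Pairwise fun j j' => IndepFun (fun W : ℕ → Option ℕ → ℝ => W i (some j) * W i' (some j))
        (fun W => W i (some j') * W i' (some j')) layerLaw)
      (lU : ∀ j, layerLaw.map (fun W => W i (some j) * W i' (some j))
        = layerLaw.map (fun W => W i (some 0) * W i' (some 0)))
      (eU : ∫ W, W i (some 0) * W i' (some 0) ∂layerLaw = if i = i' then 1 else 0) := by
    have h := strong_law_ae_mul_prod (μ := Measure.infinitePi fun _ : ℕ => μ) (ν := layerLaw)
      (Y := fun j z => ψ (z j)) (U := fun j W => W i (some j) * W i' (some j))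
      (fun j => mψ.comp (measurable_pi_apply j)) (fun j => by fun_prop)
      ((hmp 0).integrable_comp_of_integrable iψ) iU
      (fun j j' hj => (iIndepFun_infinitePi (fun _ => mψ)).indepFun hj) hU
      (fun j => by rw [hlaw, hlaw]) lU
    rwa [h0, eU] at h
  by_cases hi : i = i'
  · subst hi
    have hl (j : ℕ) : layerLaw.map (fun W => W i (some j) * W i (some j))
        = (gaussianReal 0 1).map fun x => x * x := by
      rw [← map_layerLaw_eval i (some j), Measure.map_map (by fun_prop) (by fun_prop)]; rfl
    have hm : Measurable fun W : ℕ → Option ℕ → ℝ => W i (some 0) := by fun_prop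
    refine key ?_ (fun j j' hj => ?_) (fun j => by rw [hl, hl]) ?_
    · have := integrable_sq_gaussianReal
      rw [← map_layerLaw_eval i (some 0)] at this
      exact this.comp_measurable hm
    · exact (iIndepFun_layerLaw.indepFun (i := (i, some j)) (j := (i, some j'))
        (by simpa using hj)).comp (φ := fun x => x * x) (ψ := fun x => x * x)
        (by fun_prop) (by fun_prop)
    · rw [if_pos rfl, ← integral_sq_gaussianReal, ← map_layerLaw_eval i (some 0),
        integral_map hm.aemeasurable (by fun_prop)]
  · have hl (j : ℕ) : layerLaw.map (fun W => W i (some j) * W i' (some j))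
        = ((gaussianReal 0 1).prod (gaussianReal 0 1)).map fun p => p.1 * p.2 := by
      rw [← map_layerLaw_eval_pair hi j, Measure.map_map (by fun_prop) (by fun_prop)]; rfl
    have hm : Measurable fun W : ℕ → Option ℕ → ℝ => (W i (some 0), W i' (some 0)) := by fun_prop
    refine key ?_ (fun j j' hj => ?_) (fun j => by rw [hl, hl]) ?_
    · have hid : Integrable (fun x : ℝ => x) (gaussianReal 0 1) :=
        (memLp_id_gaussianReal (μ := 0) (v := 1) 1).integrable le_rfl
      have := hid.mul_prod hid
      rw [← map_layerLaw_eval_pair hi 0] at this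
      exact this.comp_measurable hm
    · exact iIndepFun_layerLaw.indepFun_mul_mul (fun p => by fun_prop) (i, some j) (i', some j)
        (i, some j') (i', some j') (by simp [hj]) (by simp [hi]) (by simp [Ne.symm hi])
        (by simp [hj])
    · rw [if_neg hi]
      have : ∫ p : ℝ × ℝ, p.1 * p.2 ∂((gaussianReal 0 1).prod (gaussianReal 0 1)) = 0 := by
        rw [integral_prod_mul (fun x : ℝ => x) (fun x : ℝ => x), integral_id_gaussianReal, zero_mul]
      rw [← this, ← map_layerLaw_eval_pair hi 0, integral_map hm.aemeasurable (by fun_prop)]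

end GCN

/-! ### Propagation of pre-activations and of tangent kernels -/

namespace GCN

variable {V : Type*} [Fintype V] (G : GCN V)

/-- One column of the pre-activations of a layer with `d` inputs per node: `h j v` is the `j`-th
input at the node `v`, and `c` holds the parameters of the column. -/
noncomputable def column (d : ℕ) (h : ℕ → V → ℝ) (c : Option ℕ → ℝ) : EuclideanSpace ℝ V :=
  WithLp.toLp 2 fun x => ∑ v, G.A x v * (G.σw / √(d : ℝ) *
    ∑ j ∈ Finset.range d, c (some j) * h j v) + G.σb * c none

/-- The empirical second moment `(1/d) ∑ hⱼ hⱼᵀ` of the first `d` feature vectors. -/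
noncomputable def empiricalMoment (d : ℕ) (h : ℕ → V → ℝ) : Matrix V V ℝ :=
  Matrix.of fun v v' => (∑ j ∈ Finset.range d, h j v * h j v') / d

lemma dotProduct_transport (M : Matrix V V ℝ) (u : V → ℝ) :
    u ⬝ᵥ G.transport M *ᵥ u
      = G.σb ^ 2 * (∑ x, u x) ^ 2 + G.σw ^ 2 * ((G.Aᵀ *ᵥ u) ⬝ᵥ M *ᵥ (G.Aᵀ *ᵥ u)) := by
  have h1 : u ⬝ᵥ (Matrix.of fun _ _ => (1 : ℝ)) *ᵥ u = (∑ x, u x) ^ 2 := by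
    simp [dotProduct, Matrix.mulVec, ← Finset.sum_mul, pow_two]
  have h2 : u ⬝ᵥ (G.A * M * G.Aᵀ) *ᵥ u = (G.Aᵀ *ᵥ u) ⬝ᵥ M *ᵥ (G.Aᵀ *ᵥ u) := by
    rw [← Matrix.mulVec_mulVec, ← Matrix.mulVec_mulVec, Matrix.dotProduct_mulVec,
      ← Matrix.mulVec_transpose]
  rw [transport, Matrix.add_mulVec, dotProduct_add, Matrix.smul_mulVec, Matrix.smul_mulVec,
    dotProduct_smul, dotProduct_smul, h1, h2, smul_eq_mul, smul_eq_mul]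

lemma posSemidef_transport {M : Matrix V V ℝ} (hM : M.PosSemidef) :
    (G.transport M).PosSemidef := by
  refine Matrix.PosSemidef.of_dotProduct_mulVec_nonneg ?_ fun u => ?_
  · have hMt : Mᵀ = M := by simpa [Matrix.IsHermitian] using hM.isHermitian
    have : (G.transport M)ᵀ = G.transport M := by
      simp only [transport, Matrix.transpose_add, Matrix.transpose_smul, Matrix.transpose_mul,
        Matrix.transpose_transpose, hMt, Matrix.mul_assoc]
      congr 1
    simpa [Matrix.IsHermitian] using this
  · rw [star_trivial, dotProduct_transport]
    have := hM.dotProduct_mulVec_nonneg (G.Aᵀ *ᵥ u)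
    rw [star_trivial] at this
    positivity

lemma dotProduct_empiricalMoment (d : ℕ) (h : ℕ → V → ℝ) (u : V → ℝ) :
    u ⬝ᵥ empiricalMoment d h *ᵥ u = (∑ j ∈ Finset.range d, (∑ v, u v * h j v) ^ 2) / d := by
  simp only [dotProduct, Matrix.mulVec, empiricalMoment, Matrix.of_apply, Finset.sum_div,
    Finset.mul_sum, Finset.sum_mul, pow_two]
  rw [Finset.sum_congr rfl fun v _ => Finset.sum_comm, Finset.sum_comm]
  exact Finset.sum_congr rfl fun j _ => Finset.sum_congr rfl fun v _ =>
    Finset.sum_congr rfl fun v' _ => by ring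

lemma posSemidef_empiricalMoment (d : ℕ) (h : ℕ → V → ℝ) : (empiricalMoment d h).PosSemidef := by
  refine Matrix.PosSemidef.of_dotProduct_mulVec_nonneg ?_ fun u => ?_
  · ext v v'
    simp [empiricalMoment, mul_comm]
  · rw [star_trivial, dotProduct_empiricalMoment]
    positivity

/-- Given the layer inputs, a column of pre-activations is exactly Gaussian. -/
lemma map_column_colLaw [DecidableEq V] (d : ℕ) (h : ℕ → V → ℝ) :
    colLaw.map (G.column d h) = multivariateGaussian 0 (G.transport (empiricalMoment d h)) := by
  have hm : Measurable (G.column d h) := by unfold column; fun_prop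
  apply Measure.ext_of_charFun
  ext t
  rw [charFun_multivariateGaussian (G.posSemidef_transport (posSemidef_empiricalMoment d h)),
    charFun_apply, integral_map hm.aemeasurable (by fun_prop), dotProduct_transport,
    dotProduct_empiricalMoment]
  set a : Option ℕ → ℝ := fun o => o.elim (G.σb * ∑ x, t x)
    fun j => G.σw / √(d : ℝ) * ∑ v, (G.Aᵀ *ᵥ t) v * h j v with ha
  have hinner (c : Option ℕ → ℝ) : inner ℝ (G.column d h c) t
      = ∑ o ∈ Finset.insertNone (Finset.range d), a o * c o := by
    rw [Finset.sum_insertNone]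
    simp only [ha, Option.elim, EuclideanSpace.inner_eq_star_dotProduct, column, dotProduct,
      star_trivial, Matrix.mulVec, Matrix.transpose_apply, mul_add, Finset.sum_add_distrib,
      Finset.mul_sum, Finset.sum_mul]
    rw [add_comm]
    congr 1
    · exact Finset.sum_congr rfl fun x _ => by ring
    · rw [Finset.sum_congr rfl fun x _ => Finset.sum_comm, Finset.sum_comm,
        Finset.sum_congr rfl fun j _ => Finset.sum_comm]
      exact Finset.sum_congr rfl fun j _ => Finset.sum_congr rfl fun v _ =>
        Finset.sum_congr rfl fun x _ => by ring
  have hsq : ∑ o ∈ Finset.insertNone (Finset.range d), a o ^ 2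
      = G.σb ^ 2 * (∑ x, t x) ^ 2 + G.σw ^ 2 *
        ((∑ j ∈ Finset.range d, (∑ v, (G.Aᵀ *ᵥ t) v * h j v) ^ 2) / d) := by
    rw [Finset.sum_insertNone]
    simp only [ha, Option.elim, mul_pow, div_pow, Real.sq_sqrt (Nat.cast_nonneg d)]
    rw [← Finset.mul_sum]
    ring
  simp_rw [hinner]
  rw [charFun_colLaw_sum, hsq]
  congr 1
  simp
  ring

/-- The propagation of a tangent kernel `M` through a layer with `d` inputs: if `M j j'` holds the
inner products of the gradients of the pre-activations `Z j` and `Z j'`, with respect to the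
parameters of the layers up to theirs, then the result holds those of the columns `i` and `i'` of
the next pre-activations, whose parameters are `W`. -/
noncomputable def nextTangent (d : ℕ) (Z : ℕ → EuclideanSpace ℝ V) (M : ℕ → ℕ → Matrix V V ℝ)
    (W : ℕ → Option ℕ → ℝ) (i i' : ℕ) : Matrix V V ℝ :=
  (if i = i' then G.transport (empiricalMoment d fun j v => G.φ (Z j v)) else 0)
    + G.σw ^ 2 • (G.A * (Matrix.of fun v v' => (∑ j ∈ Finset.range d, ∑ j' ∈ Finset.range d,
        deriv G.φ (Z j v) * deriv G.φ (Z j' v') * M j j' v v' *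
          (W i (some j) * W i' (some j'))) / d) * G.Aᵀ)

/-- The tangent kernel of the output, computed forwards through `n` hidden layers of widths `m`,
from the pre-activations `Z` of the first hidden layer and their tangent kernel `M`. -/
noncomputable def outputTangent : (n : ℕ) → (Fin n → ℕ) → (ℕ → ℕ → Matrix V V ℝ) →
    (ℕ → EuclideanSpace ℝ V) → (Fin n → ℕ → Option ℕ → ℝ) → V → V → ℝ
  | 0, _, M, _, _ => fun x x' => M 0 0 x x'
  | n + 1, m, M, Z, θ => outputTangent n (Fin.tail m) (G.nextTangent (m 0) Z M (θ 0))
      (fun i => G.column (m 0) (fun j v => G.φ (Z j v)) (θ 0 i)) (Fin.tail θ)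

variable {G}

lemma measurable_column {Ω : Type*} [MeasurableSpace Ω] (d : ℕ) {h : Ω → ℕ → V → ℝ}
    {c : Ω → Option ℕ → ℝ} (hh : ∀ j v, Measurable fun ω => h ω j v) (hc : Measurable c) :
    Measurable fun ω => G.column d (h ω) (c ω) := by
  unfold column
  fun_prop

lemma measurable_nextTangent (hφ : Measurable G.φ) {Ω : Type*} [MeasurableSpace Ω] (d : ℕ)
    {M : Ω → ℕ → ℕ → Matrix V V ℝ} {Z : Ω → ℕ → EuclideanSpace ℝ V} {W : Ω → ℕ → Option ℕ → ℝ}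
    (hM : ∀ j j' v v', Measurable fun ω => M ω j j' v v') (hZ : Measurable Z) (hW : Measurable W)
    (i i' : ℕ) (x x' : V) :
    Measurable fun ω => G.nextTangent d (Z ω) (M ω) (W ω) i i' x x' := by
  have hd := measurable_deriv G.φ
  have h1 (j : ℕ) (v : V) : Measurable fun ω => G.φ (Z ω j v) := hφ.comp (by fun_prop)
  have h2 (j : ℕ) (v : V) : Measurable fun ω => deriv G.φ (Z ω j v) := hd.comp (by fun_prop)
  simp only [nextTangent, Matrix.add_apply, Matrix.smul_apply, Matrix.mul_apply, smul_eq_mul,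
    Matrix.of_apply, Matrix.transpose_apply]
  refine Measurable.add ?_ (by fun_prop)
  split_ifs
  · simp only [transport, empiricalMoment, Matrix.add_apply, Matrix.smul_apply, Matrix.mul_apply,
      smul_eq_mul, Matrix.of_apply, Matrix.transpose_apply]
    fun_prop
  · exact measurable_const

lemma measurable_outputTangent (hφ : Measurable G.φ) {Ω : Type*} [MeasurableSpace Ω] (n : ℕ)
    (m : Fin n → ℕ) {M : Ω → ℕ → ℕ → Matrix V V ℝ} {Z : Ω → ℕ → EuclideanSpace ℝ V}
    {θ : Ω → Fin n → ℕ → Option ℕ → ℝ} (hM : ∀ j j' v v', Measurable fun ω => M ω j j' v v')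
    (hZ : Measurable Z) (hθ : Measurable θ) :
    Measurable fun ω => G.outputTangent n m (M ω) (Z ω) (θ ω) := by
  induction n generalizing M Z with
  | zero =>
    exact measurable_pi_lambda _ fun x => measurable_pi_lambda _ fun x' => hM 0 0 x x'
  | succ n ih =>
    have hθ0 : Measurable fun ω => θ ω 0 := by fun_prop
    refine ih _ (M := fun ω => G.nextTangent (m 0) (Z ω) (M ω) (θ ω 0))
      (Z := fun ω i => G.column (m 0) (fun j v => G.φ (Z ω j v)) (θ ω 0 i))
      (measurable_nextTangent hφ (m 0) hM hZ hθ0) ?_ ?_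
    · refine measurable_pi_lambda _ fun i => measurable_column _ (fun j v => ?_) (by fun_prop)
      exact hφ.comp (by fun_prop)
    · exact measurable_pi_lambda _ fun i => by unfold Fin.tail; fun_prop

/-- Only the columns within the width of the first hidden layer matter. -/
lemma outputTangent_congr (n : ℕ) (m : Fin n → ℕ) (M : ℕ → ℕ → Matrix V V ℝ)
    {Z Z' : ℕ → EuclideanSpace ℝ V} (θ : Fin n → ℕ → Option ℕ → ℝ)
    (h : ∀ i < G.width m 1, Z i = Z' i) :
    G.outputTangent n m M Z θ = G.outputTangent n m M Z' θ := by
  cases n with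
  | zero => rfl
  | succ n =>
    have h' : ∀ j ∈ Finset.range (m 0), Z j = Z' j := fun j hj =>
      h j (by simpa [width] using hj)
    have h0 : empiricalMoment (m 0) (fun j v => G.φ (Z j v))
        = empiricalMoment (m 0) fun j v => G.φ (Z' j v) := by
      ext v v'
      simp only [empiricalMoment, Matrix.of_apply]
      congr 1
      exact Finset.sum_congr rfl fun j hj => by rw [h' j hj]
    have h1 : G.nextTangent (m 0) Z M (θ 0) = G.nextTangent (m 0) Z' M (θ 0) := by
      have hs (i i' : ℕ) (v v' : V) : ∑ j ∈ Finset.range (m 0), ∑ j' ∈ Finset.range (m 0),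
          deriv G.φ (Z j v) * deriv G.φ (Z j' v') * M j j' v v' *
            (θ 0 i (some j) * θ 0 i' (some j'))
          = ∑ j ∈ Finset.range (m 0), ∑ j' ∈ Finset.range (m 0),
          deriv G.φ (Z' j v) * deriv G.φ (Z' j' v') * M j j' v v' *
            (θ 0 i (some j) * θ 0 i' (some j')) :=
        Finset.sum_congr rfl fun j hj => Finset.sum_congr rfl fun j' hj' => by
          rw [h' j hj, h' j' hj']
      funext i i'
      simp only [nextTangent, h0, hs]
    have h2 : (fun i => G.column (m 0) (fun j v => G.φ (Z j v)) (θ 0 i))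
        = fun i => G.column (m 0) (fun j v => G.φ (Z' j v)) (θ 0 i) := by
      ext i x
      simp only [column]
      congr! 4 with v hv
      exact Finset.sum_congr rfl fun j hj => by rw [h' j hj]
    simp only [outputTangent, h1, h2]

end GCN

/-! ### Lipschitz dependence on the tangent kernel -/

namespace GCN

variable {V : Type*} [Fintype V] {G : GCN V}

lemma mul_mul_transpose_apply (A T : Matrix V V ℝ) (x x' : V) :
    (A * T * Aᵀ) x x' = ∑ u', ∑ u, A x u * T u u' * A x' u' := by
  simp only [Matrix.mul_apply, Matrix.transpose_apply, Finset.sum_mul]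

variable (G) in
/-- A Lipschitz constant of the entry `(x, x')` of `nextTangent` as a function of the tangent
kernel. -/
noncomputable def tangentBound (d : ℕ) (Z : ℕ → EuclideanSpace ℝ V) (W : ℕ → Option ℕ → ℝ)
    (i i' : ℕ) (x x' : V) : ℝ :=
  G.σw ^ 2 * ∑ u', ∑ u, |G.A x u| * ((∑ j ∈ Finset.range d, ∑ j' ∈ Finset.range d,
    |deriv G.φ (Z j u) * deriv G.φ (Z j' u')| * |W i (some j) * W i' (some j')|) / d) * |G.A x' u'|

lemma tangentBound_nonneg (d : ℕ) (Z : ℕ → EuclideanSpace ℝ V) (W : ℕ → Option ℕ → ℝ)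
    (i i' : ℕ) (x x' : V) : 0 ≤ G.tangentBound d Z W i i' x x' := by
  unfold tangentBound; positivity

lemma abs_nextTangent_sub_le (d : ℕ) (Z : ℕ → EuclideanSpace ℝ V) {M M' : ℕ → ℕ → Matrix V V ℝ}
    (W : ℕ → Option ℕ → ℝ) {ε : ℝ}
    (h : ∀ j < d, ∀ j' < d, ∀ v v', |M j j' v v' - M' j j' v v'| ≤ ε) (i i' : ℕ) (x x' : V) :
    |G.nextTangent d Z M W i i' x x' - G.nextTangent d Z M' W i i' x x'|
      ≤ G.tangentBound d Z W i i' x x' * ε := by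
  simp only [nextTangent, Matrix.add_apply, Matrix.smul_apply, mul_mul_transpose_apply,
    smul_eq_mul, add_sub_add_left_eq_sub, Matrix.of_apply, tangentBound]
  rw [← mul_sub, ← Finset.sum_sub_distrib, abs_mul, abs_of_nonneg (sq_nonneg _), mul_assoc,
    Finset.sum_mul]
  refine mul_le_mul_of_nonneg_left ?_ (sq_nonneg _)
  refine (Finset.abs_sum_le_sum_abs _ _).trans (Finset.sum_le_sum fun u' _ => ?_)
  rw [← Finset.sum_sub_distrib, Finset.sum_mul]
  refine (Finset.abs_sum_le_sum_abs _ _).trans (Finset.sum_le_sum fun u _ => ?_)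
  rw [← sub_mul, ← mul_sub, abs_mul, abs_mul, ← sub_div, ← Finset.sum_sub_distrib, abs_div,
    Nat.abs_cast, mul_right_comm _ |G.A x' u'| ε]
  refine mul_le_mul_of_nonneg_right ?_ (abs_nonneg _)
  rw [mul_assoc |G.A x u|]
  refine mul_le_mul_of_nonneg_left ?_ (abs_nonneg _)
  rw [div_mul_eq_mul_div, Finset.sum_mul]
  refine div_le_div_of_nonneg_right ?_ (Nat.cast_nonneg d)
  refine (Finset.abs_sum_le_sum_abs _ _).trans (Finset.sum_le_sum fun j hj => ?_)
  rw [← Finset.sum_sub_distrib, Finset.sum_mul]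
  refine (Finset.abs_sum_le_sum_abs _ _).trans (Finset.sum_le_sum fun j' hj' => ?_)
  rw [← sub_mul, ← mul_sub, abs_mul, abs_mul, mul_right_comm]
  exact mul_le_mul_of_nonneg_left (h j (Finset.mem_range.1 hj) j' (Finset.mem_range.1 hj') u u')
    (by positivity)

lemma measurable_tangentBound {Ω : Type*} [MeasurableSpace Ω] (d : ℕ)
    {Z : Ω → ℕ → EuclideanSpace ℝ V} {W : Ω → ℕ → Option ℕ → ℝ} (hZ : Measurable Z)
    (hW : Measurable W) (i i' : ℕ) (x x' : V) :
    Measurable fun ω => G.tangentBound d (Z ω) (W ω) i i' x x' := by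
  have hd := measurable_deriv G.φ
  have h2 (j : ℕ) (v : V) : Measurable fun ω => deriv G.φ (Z ω j v) := hd.comp (by fun_prop)
  have h3 (j j' : ℕ) (u u' : V) :
      Measurable fun ω => |deriv G.φ (Z ω j u) * deriv G.φ (Z ω j' u')| :=
    ((h2 j u).mul (h2 j' u')).abs
  have h4 (j j' : ℕ) : Measurable fun ω => |W ω i (some j) * W ω i' (some j')| :=
    Measurable.abs (by fun_prop)
  simp only [tangentBound]
  fun_prop

/-- The output tangent kernel is Lipschitz in the tangent kernel of the first hidden layer, with a
random constant. -/
lemma exists_lipschitz_outputTangent (hφ : Measurable G.φ) (n : ℕ) (m : Fin n → ℕ) :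
    ∃ c : (ℕ → EuclideanSpace ℝ V) × (Fin n → ℕ → Option ℕ → ℝ) → ℝ, Measurable c ∧
      (∀ q, 0 ≤ c q) ∧ ∀ M M' Z θ ε,
        (∀ i < G.width m 1, ∀ i' < G.width m 1, ∀ v v', |M i i' v v' - M' i i' v v'| ≤ ε) →
        ∀ x x', |G.outputTangent n m M Z θ x x' - G.outputTangent n m M' Z θ x x'|
          ≤ c (Z, θ) * ε := by
  induction n with
  | zero =>
    refine ⟨fun _ => 1, measurable_const, fun _ => zero_le_one, fun M M' Z θ ε h x x' => ?_⟩
    simpa [outputTangent] using h 0 (by simp [width]) 0 (by simp [width]) x x'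
  | succ n ih =>
    obtain ⟨c, mc, c0, hc⟩ := ih (Fin.tail m)
    set w := G.width (Fin.tail m) 1 with hw
    refine ⟨fun q => c (fun i => G.column (m 0) (fun j v => G.φ (q.1 j v)) (q.2 0 i), Fin.tail q.2)
      * ∑ i ∈ Finset.range w, ∑ i' ∈ Finset.range w, ∑ v, ∑ v',
        G.tangentBound (m 0) q.1 (q.2 0) i i' v v', ?_, ?_, ?_⟩
    · have h0 : Measurable fun q : (ℕ → EuclideanSpace ℝ V) × (Fin (n + 1) → ℕ → Option ℕ → ℝ) =>
        q.2 0 := by fun_prop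
      have h1 : Measurable fun q : (ℕ → EuclideanSpace ℝ V) × (Fin (n + 1) → ℕ → Option ℕ → ℝ) =>
          fun i => G.column (m 0) (fun j v => G.φ (q.1 j v)) (q.2 0 i) :=
        measurable_pi_lambda _ fun i => measurable_column _
          (fun j v => hφ.comp (by fun_prop)) (by fun_prop)
      have h2 : Measurable fun q : (ℕ → EuclideanSpace ℝ V) × (Fin (n + 1) → ℕ → Option ℕ → ℝ) =>
          Fin.tail q.2 := measurable_pi_lambda _ fun i => by unfold Fin.tail; fun_prop
      refine Measurable.mul (mc.comp (h1.prodMk h2)) ?_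
      exact Finset.measurable_fun_sum _ fun i _ => Finset.measurable_fun_sum _ fun i' _ =>
        Finset.measurable_fun_sum _ fun v _ => Finset.measurable_fun_sum _ fun v' _ =>
          measurable_tangentBound (m 0) measurable_fst h0 i i' v v'
    · exact fun q => mul_nonneg (c0 _) (Finset.sum_nonneg fun i _ => Finset.sum_nonneg fun i' _ =>
        Finset.sum_nonneg fun v _ => Finset.sum_nonneg fun v' _ => tangentBound_nonneg ..)
    · intro M M' Z θ ε h x x'
      simp only [outputTangent]
      rw [mul_assoc]
      refine hc _ _ _ _ _ (fun i hi i' hi' v v' => ?_) x x'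
      have hε : 0 ≤ ε ∨ m 0 = 0 := by
        rcases Nat.eq_zero_or_pos (m 0) with h0 | h0
        · exact Or.inr h0
        · have h0' : 0 < G.width m 1 := by simpa [width] using h0
          exact Or.inl ((abs_nonneg _).trans (h 0 h0' 0 h0' v v))
      have h1 := abs_nextTangent_sub_le (G := G) (m 0) Z (M := M) (M' := M') (θ 0) (ε := ε)
        (fun j hj j' hj' => h j (by simpa [width] using hj) j' (by simpa [width] using hj'))
        i i' v v'
      refine h1.trans ?_
      rcases hε with hε | h0
      · refine mul_le_mul_of_nonneg_right ?_ hε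
        have hn := fun i i' v v' => tangentBound_nonneg (G := G) (m 0) Z (θ 0) i i' v v'
        calc G.tangentBound (m 0) Z (θ 0) i i' v v'
            ≤ ∑ v', G.tangentBound (m 0) Z (θ 0) i i' v v' :=
              Finset.single_le_sum (f := fun v' => G.tangentBound (m 0) Z (θ 0) i i' v v')
                (fun _ _ => hn _ _ _ _) (Finset.mem_univ v')
          _ ≤ ∑ v, ∑ v', G.tangentBound (m 0) Z (θ 0) i i' v v' :=
              Finset.single_le_sum (f := fun v => ∑ v', G.tangentBound (m 0) Z (θ 0) i i' v v')
                (fun _ _ => Finset.sum_nonneg fun _ _ => hn _ _ _ _) (Finset.mem_univ v)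
          _ ≤ ∑ i' ∈ Finset.range w, ∑ v, ∑ v', G.tangentBound (m 0) Z (θ 0) i i' v v' :=
              Finset.single_le_sum
                (f := fun i' => ∑ v, ∑ v', G.tangentBound (m 0) Z (θ 0) i i' v v')
                (fun _ _ => Finset.sum_nonneg fun _ _ => Finset.sum_nonneg fun _ _ => hn _ _ _ _)
                (Finset.mem_range.2 hi')
          _ ≤ _ :=
              Finset.single_le_sum (f := fun i => ∑ i' ∈ Finset.range w, ∑ v, ∑ v',
                  G.tangentBound (m 0) Z (θ 0) i i' v v')
                (fun _ _ => Finset.sum_nonneg fun _ _ => Finset.sum_nonneg fun _ _ =>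
                  Finset.sum_nonneg fun _ _ => hn _ _ _ _) (Finset.mem_range.2 hi)
      · simp [tangentBound, h0]

/-- The law of the parameters of `n` layers. -/
noncomputable def netLaw (n : ℕ) : Measure (Fin n → ℕ → Option ℕ → ℝ) :=
  Measure.pi fun _ => layerLaw

instance (n : ℕ) : IsProbabilityMeasure (netLaw n) := by unfold netLaw; infer_instance

/-- The law of the columns of pre-activations that enter a layer when all layers below are
infinitely wide: independent, with the same Gaussian law. -/
noncomputable def columnsLaw [DecidableEq V] (K : Matrix V V ℝ) :
    Measure (ℕ → EuclideanSpace ℝ V) :=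
  Measure.infinitePi fun _ => multivariateGaussian 0 K

instance [DecidableEq V] (K : Matrix V V ℝ) : IsProbabilityMeasure (columnsLaw K) := by
  unfold columnsLaw; infer_instance

lemma map_columnsLaw_restrict [DecidableEq V] (K : Matrix V V ℝ) (w : ℕ) :
    (columnsLaw K).map (fun z (i : Fin w) => z i)
      = Measure.pi fun _ => multivariateGaussian 0 K := by
  rw [← Measure.infinitePi_eq_pi]
  exact Measure.map_infinitePi_infinitePi_of_inj (P := fun _ : ℕ => multivariateGaussian 0 K)
    Fin.val_injective

/-- Given the layer inputs, the columns of pre-activations are independent. -/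
lemma map_layerLaw_column [DecidableEq V] (d : ℕ) (h : ℕ → V → ℝ) (w : ℕ) :
    layerLaw.map (fun W (i : Fin w) => G.column d h (W i))
      = Measure.pi fun _ => multivariateGaussian 0 (G.transport (empiricalMoment d h)) := by
  have hm : Measurable (G.column d h) := measurable_column d (fun _ _ => measurable_const)
    measurable_id
  have h1 : layerLaw.map (fun W (i : Fin w) => W i) = Measure.infinitePi fun _ : Fin w => colLaw :=
    Measure.map_infinitePi_infinitePi_of_inj (P := fun _ : ℕ => colLaw) Fin.val_injective
  have h2 := Measure.infinitePi_map_pi (fun _ : Fin w => colLaw) (fun _ => hm)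
  have hm' : Measurable fun (W : Fin w → Option ℕ → ℝ) i => G.column d h (W i) :=
    measurable_pi_lambda _ fun i => hm.comp (measurable_pi_apply i)
  rw [← h1, Measure.map_map hm' (by fun_prop), map_column_colLaw,
    Measure.infinitePi_eq_pi] at h2
  exact h2

end GCN

/-! ### The limit of one layer -/

namespace GCN

variable {V : Type*} [Fintype V] {G : GCN V}

section kernel

variable [DecidableEq V]

lemma dotProduct_secondMoment {g : ℝ → ℝ} {K : Matrix V V ℝ}
    (hg : ∀ x, MemLp (fun z : EuclideanSpace ℝ V => g (z x)) 2 (multivariateGaussian 0 K))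
    (u : V → ℝ) :
    u ⬝ᵥ secondMoment g K *ᵥ u = ∫ z, (∑ v, u v * g (z v)) ^ 2 ∂(multivariateGaussian 0 K) := by
  have hi (v v' : V) : Integrable (fun z : EuclideanSpace ℝ V => g (z v) * g (z v'))
      (multivariateGaussian 0 K) := (hg v).integrable_mul (hg v')
  have h1 (z : EuclideanSpace ℝ V) : (∑ v, u v * g (z v)) ^ 2
      = ∑ v, ∑ v', u v * u v' * (g (z v) * g (z v')) := by
    rw [pow_two, Finset.sum_mul_sum]
    exact Finset.sum_congr rfl fun v _ => Finset.sum_congr rfl fun v' _ => by ring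
  simp_rw [h1]
  rw [integral_finsetSum _ fun v _ => integrable_finsetSum _ fun v' _ => (hi v v').const_mul _]
  simp only [dotProduct, Matrix.mulVec, Finset.mul_sum, secondMoment, Matrix.of_apply]
  refine Finset.sum_congr rfl fun v _ => ?_
  rw [integral_finsetSum _ fun v' _ => (hi v v').const_mul _]
  refine Finset.sum_congr rfl fun v' _ => ?_
  rw [integral_const_mul]
  ring

lemma posSemidef_secondMoment {g : ℝ → ℝ} {K : Matrix V V ℝ}
    (hg : ∀ x, MemLp (fun z : EuclideanSpace ℝ V => g (z x)) 2 (multivariateGaussian 0 K)) :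
    (secondMoment g K).PosSemidef := by
  refine Matrix.PosSemidef.of_dotProduct_mulVec_nonneg ?_ fun u => ?_
  · ext v v'
    simp [secondMoment, mul_comm]
  · rw [star_trivial, dotProduct_secondMoment hg]
    exact integral_nonneg fun z => sq_nonneg _

/-- In a direction `u` in which the limiting covariance of the next layer degenerates, the columns
of finite width have no fluctuations either, almost surely. -/
lemma ae_transport_empiricalMoment_mulVec_eq_zero {K : Matrix V V ℝ}
    (hg : ∀ x, MemLp (fun z : EuclideanSpace ℝ V => G.φ (z x)) 2 (multivariateGaussian 0 K))
    {u : V → ℝ} (hu : G.transport (secondMoment G.φ K) *ᵥ u = 0) :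
    ∀ᵐ z ∂(columnsLaw K), ∀ d : ℕ,
      G.transport (empiricalMoment d fun j v => G.φ (z j v)) *ᵥ u = 0 := by
  have h0 : G.σb ^ 2 * (∑ x, u x) ^ 2 + G.σw ^ 2 *
      ∫ z, (∑ v, (G.Aᵀ *ᵥ u) v * G.φ (z v)) ^ 2 ∂(multivariateGaussian 0 K) = 0 := by
    rw [← dotProduct_secondMoment hg, ← dotProduct_transport, hu, dotProduct_zero]
  have hint0 : 0 ≤ ∫ z, (∑ v, (G.Aᵀ *ᵥ u) v * G.φ (z v)) ^ 2 ∂(multivariateGaussian 0 K) :=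
    integral_nonneg fun z => sq_nonneg _
  have hb : G.σb ^ 2 * (∑ x, u x) ^ 2 = 0 := by
    have h1 : 0 ≤ G.σb ^ 2 * (∑ x, u x) ^ 2 := by positivity
    have h2 := mul_nonneg (sq_nonneg G.σw) hint0
    linarith
  rw [hb, zero_add] at h0
  have hw : ∀ᵐ z ∂(multivariateGaussian (0 : EuclideanSpace ℝ V) K),
      G.σw * ∑ v, (G.Aᵀ *ᵥ u) v * G.φ (z v) = 0 := by
    rcases mul_eq_zero.1 h0 with h | h
    · exact ae_of_all _ fun z => by rw [pow_eq_zero_iff two_ne_zero] at h; rw [h, zero_mul]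
    · have hmem : MemLp (fun z : EuclideanSpace ℝ V => ∑ v, (G.Aᵀ *ᵥ u) v * G.φ (z v)) 2
          (multivariateGaussian 0 K) := memLp_finsetSum _ fun v _ => (hg v).const_mul _
      rw [integral_eq_zero_iff_of_nonneg (fun z => sq_nonneg _) hmem.integrable_sq] at h
      filter_upwards [h] with z hz
      have hz' : (∑ v, (G.Aᵀ *ᵥ u) v * G.φ (z v)) ^ 2 = 0 := hz
      rw [pow_eq_zero_iff two_ne_zero] at hz'
      rw [hz', mul_zero]
  have hw' : ∀ᵐ z ∂(columnsLaw K), ∀ j : ℕ,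
      G.σw * ∑ v, (G.Aᵀ *ᵥ u) v * G.φ (z j v) = 0 :=
    ae_all_iff.2 fun j => (measurePreserving_eval_infinitePi
      (fun _ : ℕ => multivariateGaussian (0 : EuclideanSpace ℝ V) K) j).quasiMeasurePreserving.ae hw
  filter_upwards [hw'] with z hz d
  -- for a positive semidefinite matrix, the vanishing of the quadratic form suffices
  have hpsd := G.posSemidef_transport (posSemidef_empiricalMoment d fun j v => G.φ (z j v))
  rw [← hpsd.dotProduct_mulVec_zero_iff, star_trivial, dotProduct_transport,
    dotProduct_empiricalMoment, hb, zero_add, ← mul_div_assoc, Finset.mul_sum]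
  simp_rw [← mul_pow, hz]
  simp

/-- The tangent kernel between different columns vanishes, and all columns have the same one. -/
def diagonalKernel (Θ : Matrix V V ℝ) : ℕ → ℕ → Matrix V V ℝ := fun i i' => if i = i' then Θ else 0

omit [DecidableEq V] in
lemma nextTangent_diagonalKernel (d : ℕ) (Z : ℕ → EuclideanSpace ℝ V) (Θ : Matrix V V ℝ)
    (W : ℕ → Option ℕ → ℝ) (i i' : ℕ) :
    G.nextTangent d Z (diagonalKernel Θ) W i i'
      = (if i = i' then G.transport (empiricalMoment d fun j v => G.φ (Z j v)) else 0)
        + G.σw ^ 2 • (G.A * (Matrix.of fun v v' => (∑ j ∈ Finset.range d,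
          deriv G.φ (Z j v) * deriv G.φ (Z j v') * Θ v v' *
            (W i (some j) * W i' (some j))) / d) * G.Aᵀ) := by
  unfold nextTangent
  congr! 5
  ext v v'
  refine congrArg (· / (d : ℝ)) ?_
  refine Finset.sum_congr rfl fun j hj => ?_
  rw [Finset.sum_eq_single j]
  · simp [diagonalKernel]
  · intro j' _ hj'
    simp [diagonalKernel, Ne.symm hj']
  · exact fun h => absurd hj h

omit [DecidableEq V] in
lemma continuous_transport : Continuous G.transport := by
  unfold transport
  fun_prop

lemma ae_tendsto_empiricalMoment (hφ : Measurable G.φ) {K : Matrix V V ℝ}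
    (hg : ∀ x, MemLp (fun z : EuclideanSpace ℝ V => G.φ (z x)) 2 (multivariateGaussian 0 K)) :
    ∀ᵐ z ∂(columnsLaw K), Tendsto (fun d => empiricalMoment d fun j v => G.φ (z j v)) atTop
      (𝓝 (secondMoment G.φ K)) := by
  have h (v v' : V) := strong_law_ae_infinitePi
    (multivariateGaussian (0 : EuclideanSpace ℝ V) K) (ψ := fun z => G.φ (z v) * G.φ (z v'))
    ((hφ.comp (by fun_prop)).mul (hφ.comp (by fun_prop))) ((hg v).integrable_mul (hg v'))
  have h' := ae_all_iff.2 fun v => ae_all_iff.2 (h v)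
  filter_upwards [h'] with z hz
  exact tendsto_pi_nhds.2 fun v => tendsto_pi_nhds.2 fun v' => hz v v'

/-- The tangent kernel propagated through one layer converges, as its width grows, to a
deterministic diagonal kernel. -/
lemma ae_tendsto_nextTangent (hφ : Measurable G.φ) {K : Matrix V V ℝ}
    (hg : ∀ x, MemLp (fun z : EuclideanSpace ℝ V => G.φ (z x)) 2 (multivariateGaussian 0 K))
    (hd : ∀ x, MemLp (fun z : EuclideanSpace ℝ V => deriv G.φ (z x)) 2
      (multivariateGaussian 0 K)) (Θ : Matrix V V ℝ) :
    ∀ᵐ q ∂((columnsLaw K).prod layerLaw), ∀ i i',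
      Tendsto (fun d => G.nextTangent d q.1 (diagonalKernel Θ) q.2 i i') atTop
        (𝓝 (diagonalKernel (G.transport (Θ ⊙ secondMoment (deriv G.φ) K
          + secondMoment G.φ K)) i i')) := by
  have hdm := measurable_deriv G.φ
  have h1 (i i' : ℕ) (v v' : V) := strong_law_ae_weights
    (multivariateGaussian (0 : EuclideanSpace ℝ V) K)
    (ψ := fun z => deriv G.φ (z v) * deriv G.φ (z v') * Θ v v')
    (((hdm.comp (by fun_prop)).mul (hdm.comp (by fun_prop))).mul_const _)
    (((hd v).integrable_mul (hd v')).mul_const _) i i'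
  have h1' := ae_all_iff.2 fun i => ae_all_iff.2 fun i' => ae_all_iff.2 fun v =>
    ae_all_iff.2 (h1 i i' v)
  have h2 := Measure.quasiMeasurePreserving_fst (μ := columnsLaw K) (ν := layerLaw) |>.ae
    (ae_tendsto_empiricalMoment hφ hg)
  filter_upwards [h1', h2] with q hq1 hq2 i i'
  simp_rw [nextTangent_diagonalKernel]
  have hlim : Tendsto (fun d : ℕ => (Matrix.of fun v v' => (∑ j ∈ Finset.range d,
      deriv G.φ (q.1 j v) * deriv G.φ (q.1 j v') * Θ v v' *
        (q.2 i (some j) * q.2 i' (some j))) / d : Matrix V V ℝ)) atTop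
      (𝓝 (if i = i' then Θ ⊙ secondMoment (deriv G.φ) K else 0)) := by
    refine tendsto_pi_nhds.2 fun v => tendsto_pi_nhds.2 fun v' => ?_
    have e : (∫ z, deriv G.φ (z v) * deriv G.φ (z v') * Θ v v'
          ∂(multivariateGaussian (0 : EuclideanSpace ℝ V) K)) * (if i = i' then (1 : ℝ) else 0)
        = (if i = i' then Θ ⊙ secondMoment (deriv G.φ) K else 0) v v' := by
      split_ifs
      · rw [integral_mul_const, mul_one, Matrix.hadamard_apply, mul_comm]
        rfl
      · simp
    rw [← e]
    exact hq1 i i' v v'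
  have hlim2 := (((hlim.const_mul G.A).mul_const G.Aᵀ).const_smul (G.σw ^ 2))
  by_cases hi : i = i'
  · simp only [diagonalKernel, if_pos hi] at hlim2 ⊢
    have e : G.transport (Θ ⊙ secondMoment (deriv G.φ) K + secondMoment G.φ K)
        = G.transport (secondMoment G.φ K)
          + G.σw ^ 2 • (G.A * (Θ ⊙ secondMoment (deriv G.φ) K) * G.Aᵀ) := by
      simp only [transport, Matrix.mul_add, Matrix.add_mul, smul_add]
      abel
    rw [e]
    exact ((continuous_transport (G := G)).tendsto _).comp hq2 |>.add hlim2
  · simp only [diagonalKernel, if_neg hi] at hlim2 ⊢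
    simpa using hlim2

end kernel

end GCN

/-! ### The law of the tangent kernel and its limit in one width -/

/-- If the nonnegative variables `c d` converge setwise in law to a finite variable and `δ d` tends
to `0` in probability, then so does any sequence dominated by `c d * δ d`. -/
lemma MeasureTheory.tendstoInMeasure_of_norm_le_mul {Ω Ω' E : Type*} [MeasurableSpace Ω]
    [MeasurableSpace Ω'] [NormedAddCommGroup E] {μ : Measure Ω} {μ' : Measure Ω'}
    [IsProbabilityMeasure μ] [IsProbabilityMeasure μ'] {f : ℕ → Ω → E} {c : ℕ → Ω → ℝ}
    {c' : Ω' → ℝ} {δ : ℕ → Ω → ℝ} (hc' : Measurable c') (hc0 : ∀ d ω, 0 ≤ c d ω)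
    (hc : ∀ R : ℝ, Tendsto (fun d => μ {ω | R < c d ω}) atTop (𝓝 (μ' {ω | R < c' ω})))
    (hδ : TendstoInMeasure μ δ atTop 0) (hf : ∀ d ω, ‖f d ω‖ ≤ c d ω * δ d ω) :
    TendstoInMeasure μ f atTop 0 := by
  rw [tendstoInMeasure_iff_norm] at hδ ⊢
  intro ε hε
  rw [ENNReal.tendsto_atTop_zero]
  intro η hη
  -- the constant is at most `R`, up to an event of small probability
  obtain ⟨R, hR⟩ : ∃ R : ℕ, μ' {ω | (R : ℝ) < c' ω} < η / 2 := by
    have h : Tendsto (fun R : ℕ => μ' {ω | (R : ℝ) < c' ω}) atTop (𝓝 (μ' (⋂ R : ℕ,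
        {ω | (R : ℝ) < c' ω}))) := by
      refine tendsto_measure_iInter_atTop
        (fun R => (measurableSet_lt measurable_const hc').nullMeasurableSet) ?_
        ⟨0, measure_ne_top _ _⟩
      intro R R' hRR' ω hω
      have h : (R' : ℝ) < c' ω := hω
      exact lt_of_le_of_lt (Nat.cast_le.2 hRR') h
    have h0 : (⋂ R : ℕ, {ω | (R : ℝ) < c' ω}) = ∅ := by
      ext ω
      simp only [Set.mem_iInter, Set.mem_ofPred_eq, Set.mem_empty_iff_false, iff_false, not_forall,
        not_lt]
      exact exists_nat_ge _
    rw [h0, measure_empty] at h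
    exact (h.eventually_lt_const (ENNReal.half_pos hη.ne')).exists
  have h1 := (hc R).eventually_lt_const hR
  have hε' : 0 < ε / (R + 1) := by positivity
  have h2 := (hδ _ hε').eventually_lt_const (ENNReal.half_pos hη.ne')
  obtain ⟨N, hN⟩ := eventually_atTop.1 (h1.and h2)
  refine ⟨N, fun d hd => ?_⟩
  have hsub : {ω | ε ≤ ‖f d ω - (0 : Ω → E) ω‖} ⊆ {ω | (R : ℝ) < c d ω} ∪
      {ω | ε / (R + 1) ≤ ‖δ d ω - (0 : Ω → ℝ) ω‖} := by
    intro ω hω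
    by_contra hcon
    simp only [Set.mem_union, Set.mem_ofPred_eq, not_or, not_lt, not_le, Pi.zero_apply,
      sub_zero] at hcon hω
    have h3 : δ d ω < ε / (R + 1) := (le_abs_self _).trans_lt hcon.2
    rw [lt_div_iff₀ (by positivity)] at h3
    have h4 := hω.trans (hf d ω)
    have h5 := hc0 d ω
    rcases le_or_gt (δ d ω) 0 with h6 | h6
    · nlinarith
    · nlinarith
  calc μ {ω | ε ≤ ‖f d ω - (0 : Ω → E) ω‖} ≤ _ := measure_mono hsub
    _ ≤ _ := measure_union_le _ _
    _ ≤ η / 2 + η / 2 := add_le_add (hN d hd).1.le (hN d hd).2.le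
    _ = η := ENNReal.add_halves η

namespace GCN

/-- The first `w` columns, continued by zero. -/
noncomputable def extendColumns {V : Type*} (w : ℕ) (y : Fin w → EuclideanSpace ℝ V) :
    ℕ → EuclideanSpace ℝ V := fun i => if h : i < w then y ⟨i, h⟩ else 0

lemma measurable_extendColumns {V : Type*} (w : ℕ) : Measurable (extendColumns (V := V) w) := by
  refine measurable_pi_lambda _ fun i => ?_
  unfold extendColumns
  split_ifs <;> fun_prop

lemma measurable_integral_netLaw {V : Type*} {w n : ℕ}
    {g : (ℕ → EuclideanSpace ℝ V) × (Fin n → ℕ → Option ℕ → ℝ) → ℝ} (mg : Measurable g) :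
    Measurable fun y : Fin w → EuclideanSpace ℝ V =>
      ∫ θ, g (extendColumns w y, θ) ∂(netLaw n) := by
  have m : Measurable fun q : (Fin w → EuclideanSpace ℝ V) × (Fin n → ℕ → Option ℕ → ℝ) =>
      g (extendColumns w q.1, q.2) :=
    mg.comp (((measurable_extendColumns w).comp measurable_fst).prodMk measurable_snd)
  exact (StronglyMeasurable.integral_prod_right (ν := netLaw n)
    (f := fun y θ => g (extendColumns w y, θ)) m.stronglyMeasurable).measurable

variable {V : Type*} [Fintype V] {G : GCN V}

lemma outputTangent_extendColumns (n : ℕ) (m : Fin n → ℕ) (M : ℕ → ℕ → Matrix V V ℝ)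
    (Z : ℕ → EuclideanSpace ℝ V) (θ : Fin n → ℕ → Option ℕ → ℝ) :
    G.outputTangent n m M (extendColumns (G.width m 1) fun i => Z i) θ
      = G.outputTangent n m M Z θ :=
  outputTangent_congr n m M θ fun i hi => by simp [extendColumns, hi]

variable (G) in
/-- The columns of the next pre-activations. -/
noncomputable def nextColumns (d : ℕ) (z : ℕ → EuclideanSpace ℝ V) (W : ℕ → Option ℕ → ℝ) :
    ℕ → EuclideanSpace ℝ V := fun i => G.column d (fun j v => G.φ (z j v)) (W i)

lemma measurable_nextColumns (hφ : Measurable G.φ) (d : ℕ) :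
    Measurable fun q : (ℕ → EuclideanSpace ℝ V) × (ℕ → Option ℕ → ℝ) =>
      G.nextColumns d q.1 q.2 :=
  measurable_pi_lambda _ fun i => measurable_column d (fun j v => hφ.comp (by fun_prop))
    (by fun_prop)

lemma integral_layerLaw_nextColumns [DecidableEq V] (d w : ℕ) (z : ℕ → EuclideanSpace ℝ V)
    {g₀ : (Fin w → EuclideanSpace ℝ V) → ℝ} (mg₀ : Measurable g₀) :
    ∫ W, g₀ (fun i => G.nextColumns d z W i) ∂layerLaw
      = ∫ y, g₀ y ∂(Measure.pi fun _ : Fin w => multivariateGaussian 0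
          (G.transport (empiricalMoment d fun j v => G.φ (z j v)))) := by
  have m1 : Measurable fun (W : ℕ → Option ℕ → ℝ) (i : Fin w) =>
      G.column d (fun j v => G.φ (z j v)) (W i) :=
    measurable_pi_lambda _ fun i => measurable_column d (fun _ _ => measurable_const)
      (measurable_pi_apply _)
  rw [← map_layerLaw_column, integral_map m1.aemeasurable mg₀.aestronglyMeasurable]
  rfl

variable [DecidableEq V]

lemma integral_columnsLaw_extendColumns (S : Matrix V V ℝ) (n w : ℕ)
    {g : (ℕ → EuclideanSpace ℝ V) × (Fin n → ℕ → Option ℕ → ℝ) → ℝ} (mg : Measurable g) {c : ℝ}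
    (hc : ∀ q, |g q| ≤ c) :
    ∫ p, g (extendColumns w (fun i => p.1 i), p.2) ∂((columnsLaw S).prod (netLaw n))
      = ∫ y, (∫ θ, g (extendColumns w y, θ) ∂(netLaw n))
          ∂(Measure.pi fun _ : Fin w => multivariateGaussian 0 S) := by
  have mr : Measurable fun (Z : ℕ → EuclideanSpace ℝ V) (i : Fin w) => Z i := by fun_prop
  have m : Measurable fun p : (ℕ → EuclideanSpace ℝ V) × (Fin n → ℕ → Option ℕ → ℝ) =>
      g (extendColumns w (fun i => p.1 i), p.2) :=
    mg.comp (((measurable_extendColumns w).comp (mr.comp measurable_fst)).prodMk measurable_snd)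
  have hi : Integrable (fun p : (ℕ → EuclideanSpace ℝ V) × (Fin n → ℕ → Option ℕ → ℝ) =>
      g (extendColumns w (fun i => p.1 i), p.2)) ((columnsLaw S).prod (netLaw n)) :=
    Integrable.of_bound m.aestronglyMeasurable c (ae_of_all _ fun _ => hc _)
  rw [integral_prod _ hi, ← map_columnsLaw_restrict, integral_map mr.aemeasurable
    (measurable_integral_netLaw mg).aestronglyMeasurable]

lemma integral_nextColumns (hφ : Measurable G.φ) (K : Matrix V V ℝ) (n w d : ℕ)
    {g : (ℕ → EuclideanSpace ℝ V) × (Fin n → ℕ → Option ℕ → ℝ) → ℝ} (mg : Measurable g) {c : ℝ}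
    (hc : ∀ q, |g q| ≤ c) :
    ∫ ω, g (extendColumns w (fun i => G.nextColumns d ω.1.1 ω.1.2 i), ω.2)
        ∂(((columnsLaw K).prod layerLaw).prod (netLaw n))
      = ∫ z, (∫ W, (∫ θ, g (extendColumns w (fun i => G.nextColumns d z W i), θ) ∂(netLaw n))
          ∂layerLaw) ∂(columnsLaw K) := by
  have mr : Measurable fun (Z : ℕ → EuclideanSpace ℝ V) (i : Fin w) => Z i := by fun_prop
  have mZ : Measurable fun q : (ℕ → EuclideanSpace ℝ V) × (ℕ → Option ℕ → ℝ) =>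
      fun i : Fin w => G.nextColumns d q.1 q.2 i := mr.comp (measurable_nextColumns hφ d)
  have m : Measurable fun ω :
      ((ℕ → EuclideanSpace ℝ V) × (ℕ → Option ℕ → ℝ)) × (Fin n → ℕ → Option ℕ → ℝ) =>
      g (extendColumns w (fun i => G.nextColumns d ω.1.1 ω.1.2 i), ω.2) :=
    mg.comp (((measurable_extendColumns w).comp (mZ.comp measurable_fst)).prodMk measurable_snd)
  have hi : Integrable (fun ω :
      ((ℕ → EuclideanSpace ℝ V) × (ℕ → Option ℕ → ℝ)) × (Fin n → ℕ → Option ℕ → ℝ) =>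
      g (extendColumns w (fun i => G.nextColumns d ω.1.1 ω.1.2 i), ω.2))
      (((columnsLaw K).prod layerLaw).prod (netLaw n)) :=
    Integrable.of_bound m.aestronglyMeasurable c (ae_of_all _ fun _ => hc _)
  rw [integral_prod _ hi, integral_prod _ hi.integral_prod_left]

/-- As the width of a layer grows, finitely many of the columns of the next pre-activations converge
in law, jointly with independent parameters, setwise: the test function `g` need not be
continuous. -/
theorem tendsto_integral_nextColumns (hφ : Measurable G.φ) {K : Matrix V V ℝ}
    (hg : ∀ x, MemLp (fun z : EuclideanSpace ℝ V => G.φ (z x)) 2 (multivariateGaussian 0 K))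
    (n w : ℕ) {g : (ℕ → EuclideanSpace ℝ V) × (Fin n → ℕ → Option ℕ → ℝ) → ℝ}
    (mg : Measurable g) {c : ℝ} (hc : ∀ q, |g q| ≤ c) :
    Tendsto (fun d => ∫ ω, g (extendColumns w (fun i => G.nextColumns d ω.1.1 ω.1.2 i), ω.2)
        ∂(((columnsLaw K).prod layerLaw).prod (netLaw n))) atTop
      (𝓝 (∫ p, g (extendColumns w (fun i => p.1 i), p.2)
        ∂((columnsLaw (G.transport (secondMoment G.φ K))).prod (netLaw n)))) := by
  set S := G.transport (secondMoment G.φ K) with hS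
  have mg₀ := measurable_integral_netLaw (w := w) mg
  rw [integral_columnsLaw_extendColumns S n w mg hc]
  simp_rw [integral_nextColumns hφ K n w _ mg hc]
  set g₀ : (Fin w → EuclideanSpace ℝ V) → ℝ := fun y => ∫ θ, g (extendColumns w y, θ) ∂(netLaw n)
    with hg₀
  have hc0 (y) : |g₀ y| ≤ c := by
    have := norm_integral_le_of_norm_le_const (μ := netLaw n)
      (f := fun θ => g (extendColumns w y, θ)) (ae_of_all _ fun θ => hc _)
    simpa using this
  have hSpsd : S.PosSemidef := G.posSemidef_transport (posSemidef_secondMoment hg)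
  obtain ⟨N, hN0, hN⟩ := exists_kernel_tendsto_integral_pi_multivariateGaussian hSpsd
  have hker : ∀ᵐ z ∂(columnsLaw K), ∀ y : V, ∀ d : ℕ,
      G.transport (empiricalMoment d fun j v => G.φ (z j v)) *ᵥ (fun x => N x y) = 0 := by
    refine ae_all_iff.2 fun y => ae_transport_empiricalMoment_mulVec_eq_zero hg ?_
    ext x
    exact congrFun (congrFun hN0 x) y
  have hconst : (∫ y, g₀ y ∂(Measure.pi fun _ : Fin w => multivariateGaussian 0 S))
      = ∫ _z, (∫ y, g₀ y ∂(Measure.pi fun _ : Fin w => multivariateGaussian 0 S))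
        ∂(columnsLaw K) := by simp
  rw [hconst]
  refine tendsto_integral_of_dominated_convergence (fun _ => c) (fun d => ?_)
    (integrable_const c) (fun d => ae_of_all _ fun z => ?_) ?_
  · have m : Measurable fun q : (ℕ → EuclideanSpace ℝ V) × (ℕ → Option ℕ → ℝ) =>
        g₀ fun i => G.nextColumns d q.1 q.2 i := by
      have mr : Measurable fun (Z : ℕ → EuclideanSpace ℝ V) (i : Fin w) => Z i := by fun_prop
      exact mg₀.comp (mr.comp (measurable_nextColumns hφ d))
    exact (StronglyMeasurable.integral_prod_right (ν := layerLaw)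
      (f := fun z W => g₀ fun i => G.nextColumns d z W i)
      m.stronglyMeasurable).aestronglyMeasurable
  · have := norm_integral_le_of_norm_le_const (μ := layerLaw)
      (f := fun W => g₀ fun i => G.nextColumns d z W i) (ae_of_all _ fun y => hc0 _)
    simpa using this
  · filter_upwards [hker, ae_tendsto_empiricalMoment hφ hg] with z hz1 hz2
    have h := hN (Fin w) (fun d => G.transport (empiricalMoment d fun j v => G.φ (z j v)))
      (fun d => G.posSemidef_transport (posSemidef_empiricalMoment _ _))
      (((continuous_transport (G := G)).tendsto _).comp hz2) (fun d => by
        ext x y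
        exact congrFun (hz1 y d) x) g₀ c mg₀ hc0
    exact h.congr fun d => (integral_layerLaw_nextColumns d w z mg₀).symm

omit [DecidableEq V] in
lemma measurable_outputTangent_const (hφ : Measurable G.φ) (n : ℕ) (m : Fin n → ℕ)
    (M : ℕ → ℕ → Matrix V V ℝ) :
    Measurable fun p : (ℕ → EuclideanSpace ℝ V) × (Fin n → ℕ → Option ℕ → ℝ) =>
      G.outputTangent n m M p.1 p.2 :=
  measurable_outputTangent (Ω := (ℕ → EuclideanSpace ℝ V) × (Fin n → ℕ → Option ℕ → ℝ)) hφ n m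
    (M := fun _ => M) (Z := Prod.fst) (θ := Prod.snd) (fun _ _ _ _ => measurable_const)
    measurable_fst measurable_snd

omit [DecidableEq V] in
lemma measurable_nextTangent_const (hφ : Measurable G.φ) (d : ℕ) (M : ℕ → ℕ → Matrix V V ℝ)
    (i i' : ℕ) (v v' : V) :
    Measurable fun q : (ℕ → EuclideanSpace ℝ V) × (ℕ → Option ℕ → ℝ) =>
      G.nextTangent d q.1 M q.2 i i' v v' :=
  measurable_nextTangent (Ω := (ℕ → EuclideanSpace ℝ V) × (ℕ → Option ℕ → ℝ)) hφ d
    (M := fun _ => M) (Z := Prod.fst) (W := Prod.snd)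
    (fun _ _ _ _ => measurable_const) measurable_fst measurable_snd i i' v v'

omit [DecidableEq V] in
lemma measurable_outputTangent_next (hφ : Measurable G.φ) (n d : ℕ) (m : Fin n → ℕ)
    (M : ℕ → ℕ → Matrix V V ℝ) :
    Measurable fun ω :
      ((ℕ → EuclideanSpace ℝ V) × (ℕ → Option ℕ → ℝ)) × (Fin n → ℕ → Option ℕ → ℝ) =>
      G.outputTangent n m (G.nextTangent d ω.1.1 M ω.1.2) (G.nextColumns d ω.1.1 ω.1.2) ω.2 :=
  measurable_outputTangent
    (Ω := ((ℕ → EuclideanSpace ℝ V) × (ℕ → Option ℕ → ℝ)) × (Fin n → ℕ → Option ℕ → ℝ)) hφ n m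
    (M := fun ω => G.nextTangent d ω.1.1 M ω.1.2)
    (Z := fun ω => G.nextColumns d ω.1.1 ω.1.2) (θ := Prod.snd)
    (fun j j' v v' => (measurable_nextTangent_const hφ d M j j' v v').comp measurable_fst)
    ((measurable_nextColumns hφ d).comp measurable_fst) measurable_snd

variable (G) in
/-- The law of the tangent kernel of the network with `n` hidden layers of widths `m` left, after
all layers below have become infinitely wide: `K` and `Θ` are the covariance and the tangent kernel
of the pre-activations of the first hidden layer left. -/
noncomputable def tangentLaw (hφ : Measurable G.φ) (n : ℕ) (m : Fin n → ℕ) (K Θ : Matrix V V ℝ) :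
    ProbabilityMeasure (V → V → ℝ) :=
  ⟨((columnsLaw K).prod (netLaw n)).map
      fun p => G.outputTangent n m (diagonalKernel Θ) p.1 p.2,
    Measure.isProbabilityMeasure_map (measurable_outputTangent_const hφ n m _).aemeasurable⟩

/-- The first hidden layer peeled off. -/
lemma tangentLaw_succ (hφ : Measurable G.φ) (n d : ℕ) (m : Fin n → ℕ) (K Θ : Matrix V V ℝ) :
    (tangentLaw G hφ (n + 1) (Fin.cons d m) K Θ : Measure (V → V → ℝ))
      = (((columnsLaw K).prod layerLaw).prod (netLaw n)).map fun ω =>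
        G.outputTangent n m (G.nextTangent d ω.1.1 (diagonalKernel Θ) ω.1.2)
          (G.nextColumns d ω.1.1 ω.1.2) ω.2 := by
  have h1 : MeasurePreserving (MeasurableEquiv.piFinSuccAbove (fun _ => ℕ → Option ℕ → ℝ) 0)
      (netLaw (n + 1)) (layerLaw.prod (netLaw n)) :=
    measurePreserving_piFinSuccAbove (fun _ : Fin (n + 1) => layerLaw) 0
  have h2 := ((MeasurePreserving.id (columnsLaw K)).prod h1)
  have h3 := (measurePreserving_prodAssoc (columnsLaw K) layerLaw (netLaw n)).symm.comp h2
  rw [← h3.map_eq, Measure.map_map (measurable_outputTangent_next hφ n d m _) h3.measurable]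
  have hfun : (fun p : (ℕ → EuclideanSpace ℝ V) × (Fin (n + 1) → ℕ → Option ℕ → ℝ) =>
      G.outputTangent (n + 1) (Fin.cons d m) (diagonalKernel Θ) p.1 p.2)
    = (fun ω => G.outputTangent n m (G.nextTangent d ω.1.1 (diagonalKernel Θ) ω.1.2)
          (G.nextColumns d ω.1.1 ω.1.2) ω.2) ∘ MeasurableEquiv.prodAssoc.symm ∘
        Prod.map id (MeasurableEquiv.piFinSuccAbove (fun _ => ℕ → Option ℕ → ℝ) 0) := by
    funext p
    rfl
  rw [← hfun]
  rfl

/-- With the limiting tangent kernel in place, setwise convergence of the columns is all that is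
needed. -/
lemma tendstoInDistribution_nextColumns (hφ : Measurable G.φ) {K : Matrix V V ℝ}
    (hg : ∀ x, MemLp (fun z : EuclideanSpace ℝ V => G.φ (z x)) 2 (multivariateGaussian 0 K))
    (M : ℕ → ℕ → Matrix V V ℝ) (n : ℕ) (m : Fin n → ℕ) :
    TendstoInDistribution (fun d (ω :
        ((ℕ → EuclideanSpace ℝ V) × (ℕ → Option ℕ → ℝ)) × (Fin n → ℕ → Option ℕ → ℝ)) =>
        G.outputTangent n m M (G.nextColumns d ω.1.1 ω.1.2) ω.2) atTop
      (fun p : (ℕ → EuclideanSpace ℝ V) × (Fin n → ℕ → Option ℕ → ℝ) =>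
        G.outputTangent n m M p.1 p.2) (fun _ => ((columnsLaw K).prod layerLaw).prod (netLaw n))
      ((columnsLaw (G.transport (secondMoment G.φ K))).prod (netLaw n)) := by
  have mO := measurable_outputTangent_const hφ n m M
  have mX (d : ℕ) : Measurable fun ω :
      ((ℕ → EuclideanSpace ℝ V) × (ℕ → Option ℕ → ℝ)) × (Fin n → ℕ → Option ℕ → ℝ) =>
        G.outputTangent n m M (G.nextColumns d ω.1.1 ω.1.2) ω.2 :=
    mO.comp (((measurable_nextColumns hφ d).comp measurable_fst).prodMk measurable_snd)
  refine ⟨fun d => (mX d).aemeasurable, mO.aemeasurable, ?_⟩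
  refine ProbabilityMeasure.tendsto_iff_forall_integral_tendsto.2 fun f => ?_
  change Tendsto (fun d => ∫ y, f y ∂(Measure.map (fun ω => G.outputTangent n m M
      (G.nextColumns d ω.1.1 ω.1.2) ω.2) (((columnsLaw K).prod layerLaw).prod (netLaw n)))) atTop
    (𝓝 (∫ y, f y ∂(Measure.map (fun p => G.outputTangent n m M p.1 p.2)
      ((columnsLaw (G.transport (secondMoment G.φ K))).prod (netLaw n)))))
  rw [integral_map mO.aemeasurable f.continuous.measurable.aestronglyMeasurable]
  have h := tendsto_integral_nextColumns hφ hg n (G.width m 1)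
    (g := fun p => f (G.outputTangent n m M p.1 p.2)) (f.continuous.measurable.comp mO)
    (c := ‖f‖) fun q => f.norm_coe_le_norm _
  simp only [outputTangent_extendColumns] at h
  refine h.congr fun d => ?_
  rw [integral_map (mX d).aemeasurable f.continuous.measurable.aestronglyMeasurable]

lemma tendsto_measure_nextColumns (hφ : Measurable G.φ) {K : Matrix V V ℝ}
    (hg : ∀ x, MemLp (fun z : EuclideanSpace ℝ V => G.φ (z x)) 2 (multivariateGaussian 0 K))
    (n w : ℕ) {s : Set ((ℕ → EuclideanSpace ℝ V) × (Fin n → ℕ → Option ℕ → ℝ))}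
    (hs : MeasurableSet s) :
    Tendsto (fun d => (((columnsLaw K).prod layerLaw).prod (netLaw n))
        {ω | (extendColumns w (fun i => G.nextColumns d ω.1.1 ω.1.2 i), ω.2) ∈ s}) atTop
      (𝓝 (((columnsLaw (G.transport (secondMoment G.φ K))).prod (netLaw n))
        {p | (extendColumns w (fun i => p.1 i), p.2) ∈ s})) := by
  have h := tendsto_integral_nextColumns hφ hg n w (g := s.indicator fun _ => 1) (c := 1)
    (measurable_const.indicator hs) fun q => by
      by_cases hq : q ∈ s <;> simp [hq]
  have mr : Measurable fun (Z : ℕ → EuclideanSpace ℝ V) (i : Fin w) => Z i := by fun_prop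
  have mp : Measurable fun p : (ℕ → EuclideanSpace ℝ V) × (Fin n → ℕ → Option ℕ → ℝ) =>
      (extendColumns w (fun i => p.1 i), p.2) :=
    ((measurable_extendColumns w).comp (mr.comp measurable_fst)).prodMk measurable_snd
  have mω (d : ℕ) : Measurable fun ω :
      ((ℕ → EuclideanSpace ℝ V) × (ℕ → Option ℕ → ℝ)) × (Fin n → ℕ → Option ℕ → ℝ) =>
      (extendColumns w (fun i => G.nextColumns d ω.1.1 ω.1.2 i), ω.2) :=
    ((measurable_extendColumns w).comp (mr.comp
      ((measurable_nextColumns hφ d).comp measurable_fst))).prodMk measurable_snd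
  rw [← ENNReal.tendsto_toReal_iff (fun _ => measure_ne_top _ _) (measure_ne_top _ _)]
  have e1 : ∫ p, s.indicator (fun _ => (1 : ℝ)) (extendColumns w (fun i => p.1 i), p.2)
      ∂((columnsLaw (G.transport (secondMoment G.φ K))).prod (netLaw n))
      = (((columnsLaw (G.transport (secondMoment G.φ K))).prod (netLaw n))
        {p | (extendColumns w (fun i => p.1 i), p.2) ∈ s}).toReal :=
    integral_indicator_one (mp hs)
  have e2 (d : ℕ) : ∫ ω, s.indicator (fun _ => (1 : ℝ))
        (extendColumns w (fun i => G.nextColumns d ω.1.1 ω.1.2 i), ω.2)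
        ∂(((columnsLaw K).prod layerLaw).prod (netLaw n))
      = ((((columnsLaw K).prod layerLaw).prod (netLaw n))
        {ω | (extendColumns w (fun i => G.nextColumns d ω.1.1 ω.1.2 i), ω.2) ∈ s}).toReal :=
    integral_indicator_one (mω d hs)
  rw [e1] at h
  exact h.congr e2

/-- The tangent kernel of the first hidden layer left may be replaced by its limit. -/
lemma tendstoInMeasure_outputTangent_sub (hφ : Measurable G.φ) {K : Matrix V V ℝ}
    (hg : ∀ x, MemLp (fun z : EuclideanSpace ℝ V => G.φ (z x)) 2 (multivariateGaussian 0 K))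
    (hd : ∀ x, MemLp (fun z : EuclideanSpace ℝ V => deriv G.φ (z x)) 2
      (multivariateGaussian 0 K)) (Θ : Matrix V V ℝ) (n : ℕ) (m : Fin n → ℕ) :
    TendstoInMeasure (((columnsLaw K).prod layerLaw).prod (netLaw n)) (fun d ω =>
      G.outputTangent n m (G.nextTangent d ω.1.1 (diagonalKernel Θ) ω.1.2)
        (G.nextColumns d ω.1.1 ω.1.2) ω.2
      - G.outputTangent n m (diagonalKernel
          (G.transport (Θ ⊙ secondMoment (deriv G.φ) K + secondMoment G.φ K)))
        (G.nextColumns d ω.1.1 ω.1.2) ω.2) atTop 0 := by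
  set Θ' := G.transport (Θ ⊙ secondMoment (deriv G.φ) K + secondMoment G.φ K) with hΘ'
  obtain ⟨c, mc, c0, hc⟩ := exists_lipschitz_outputTangent hφ n m
  let δ : ℕ → ((ℕ → EuclideanSpace ℝ V) × (ℕ → Option ℕ → ℝ)) × (Fin n → ℕ → Option ℕ → ℝ) →
    ℝ := fun d ω => ∑ i ∈ Finset.range (G.width m 1), ∑ i' ∈ Finset.range (G.width m 1), ∑ v, ∑ v',
      |G.nextTangent d ω.1.1 (diagonalKernel Θ) ω.1.2 i i' v v' - diagonalKernel Θ' i i' v v'|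
  have mδ (d : ℕ) : Measurable (δ d) :=
    Finset.measurable_fun_sum _ fun i _ => Finset.measurable_fun_sum _ fun i' _ =>
      Finset.measurable_fun_sum _ fun v _ => Finset.measurable_fun_sum _ fun v' _ =>
        (((measurable_nextTangent_const hφ d _ i i' v v').comp measurable_fst).sub_const _).abs
  have hδ0 (d) (ω) : 0 ≤ δ d ω := Finset.sum_nonneg fun i _ => Finset.sum_nonneg fun i' _ =>
    Finset.sum_nonneg fun v _ => Finset.sum_nonneg fun v' _ => abs_nonneg _
  have hδlim : TendstoInMeasure (((columnsLaw K).prod layerLaw).prod (netLaw n)) δ atTop 0 := by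
    refine tendstoInMeasure_of_tendsto_ae (fun d => (mδ d).aestronglyMeasurable) ?_
    filter_upwards [Measure.quasiMeasurePreserving_fst.ae
      (ae_tendsto_nextTangent hφ hg hd Θ)] with ω hω
    have : Tendsto (fun d => δ d ω) atTop (𝓝 (∑ i ∈ Finset.range (G.width m 1),
        ∑ i' ∈ Finset.range (G.width m 1), ∑ v : V, ∑ v' : V, 0)) := by
      refine tendsto_finsetSum _ fun i _ => tendsto_finsetSum _ fun i' _ =>
        tendsto_finsetSum _ fun v _ => tendsto_finsetSum _ fun v' _ => ?_
      have h1 := tendsto_pi_nhds.1 (tendsto_pi_nhds.1 (hω i i') v) v'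
      have h2 : Tendsto (fun d => |G.nextTangent d ω.1.1 (diagonalKernel Θ) ω.1.2 i i' v v'
          - diagonalKernel Θ' i i' v v'|) atTop
          (𝓝 |diagonalKernel Θ' i i' v v' - diagonalKernel Θ' i i' v v'|) :=
        (h1.sub_const (diagonalKernel Θ' i i' v v')).abs
      simpa using h2
    simpa using this
  have mr : Measurable fun (Z : ℕ → EuclideanSpace ℝ V) (i : Fin (G.width m 1)) => Z i := by
    fun_prop
  have mp : Measurable fun p : (ℕ → EuclideanSpace ℝ V) × (Fin n → ℕ → Option ℕ → ℝ) =>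
      c (extendColumns (G.width m 1) (fun i => p.1 i), p.2) :=
    mc.comp (((measurable_extendColumns (G.width m 1)).comp
      (mr.comp measurable_fst)).prodMk measurable_snd)
  refine tendstoInMeasure_of_norm_le_mul
    (μ' := (columnsLaw (G.transport (secondMoment G.φ K))).prod (netLaw n))
    (c := fun d ω => c (extendColumns (G.width m 1) fun i => G.nextColumns d ω.1.1 ω.1.2 i, ω.2))
    (c' := fun p => c (extendColumns (G.width m 1) fun i => p.1 i, p.2)) (δ := δ) mp
    (fun _ _ => c0 _)
    (fun R => tendsto_measure_nextColumns hφ hg n (G.width m 1) (s := {q | R < c q})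
      (measurableSet_lt measurable_const mc)) hδlim fun d ω => ?_
  have hle : ∀ i < G.width m 1, ∀ i' < G.width m 1, ∀ v v',
      |G.nextTangent d ω.1.1 (diagonalKernel Θ) ω.1.2 i i' v v'
        - diagonalKernel Θ' i i' v v'| ≤ δ d ω := by
    intro i hi i' hi' v v'
    let e : ℕ → ℕ → V → V → ℝ := fun i i' v v' =>
      |G.nextTangent d ω.1.1 (diagonalKernel Θ) ω.1.2 i i' v v' - diagonalKernel Θ' i i' v v'|
    have he (i i' v v') : 0 ≤ e i i' v v' := abs_nonneg _
    calc e i i' v v' ≤ ∑ v', e i i' v v' :=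
          Finset.single_le_sum (f := fun v' => e i i' v v') (fun _ _ => he _ _ _ _)
            (Finset.mem_univ v')
      _ ≤ ∑ v, ∑ v', e i i' v v' :=
          Finset.single_le_sum (f := fun v => ∑ v', e i i' v v')
            (fun _ _ => Finset.sum_nonneg fun _ _ => he _ _ _ _) (Finset.mem_univ v)
      _ ≤ ∑ i' ∈ Finset.range (G.width m 1), ∑ v, ∑ v', e i i' v v' :=
          Finset.single_le_sum (f := fun i' => ∑ v, ∑ v', e i i' v v')
            (fun _ _ => Finset.sum_nonneg fun _ _ => Finset.sum_nonneg fun _ _ => he _ _ _ _)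
            (Finset.mem_range.2 hi')
      _ ≤ δ d ω :=
          Finset.single_le_sum 
            (f := fun i => ∑ i' ∈ Finset.range (G.width m 1), ∑ v, ∑ v', e i i' v v')
            (fun _ _ => Finset.sum_nonneg fun _ _ => Finset.sum_nonneg fun _ _ =>
              Finset.sum_nonneg fun _ _ => he _ _ _ _) (Finset.mem_range.2 hi)
  have h := hc _ _ (extendColumns (G.width m 1) fun i => G.nextColumns d ω.1.1 ω.1.2 i) ω.2 _ hle
  simp only [outputTangent_extendColumns] at h
  rw [pi_norm_le_iff_of_nonneg (mul_nonneg (c0 _) (hδ0 d ω))]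
  intro x
  rw [pi_norm_le_iff_of_nonneg (mul_nonneg (c0 _) (hδ0 d ω))]
  exact h x

/-- The limit in the width of the first hidden layer. -/
theorem tendsto_tangentLaw (hφ : Measurable G.φ) {K : Matrix V V ℝ}
    (hg : ∀ x, MemLp (fun z : EuclideanSpace ℝ V => G.φ (z x)) 2 (multivariateGaussian 0 K))
    (hd : ∀ x, MemLp (fun z : EuclideanSpace ℝ V => deriv G.φ (z x)) 2
      (multivariateGaussian 0 K)) (Θ : Matrix V V ℝ) (n : ℕ) (m : Fin n → ℕ) :
    Tendsto (fun d => tangentLaw G hφ (n + 1) (Fin.cons d m) K Θ) atTop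
      (𝓝 (tangentLaw G hφ n m (G.transport (secondMoment G.φ K))
        (G.transport (Θ ⊙ secondMoment (deriv G.φ) K + secondMoment G.φ K)))) := by
  -- `Y` is the tangent kernel, and `X` the one with the limit put in for the first hidden layer
  let X : ℕ → ((ℕ → EuclideanSpace ℝ V) × (ℕ → Option ℕ → ℝ)) × (Fin n → ℕ → Option ℕ → ℝ) →
    V → V → ℝ := fun d ω => G.outputTangent n m (diagonalKernel
      (G.transport (Θ ⊙ secondMoment (deriv G.φ) K + secondMoment G.φ K)))
      (G.nextColumns d ω.1.1 ω.1.2) ω.2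
  let Y : ℕ → ((ℕ → EuclideanSpace ℝ V) × (ℕ → Option ℕ → ℝ)) × (Fin n → ℕ → Option ℕ → ℝ) →
    V → V → ℝ := fun d ω => G.outputTangent n m
      (G.nextTangent d ω.1.1 (diagonalKernel Θ) ω.1.2) (G.nextColumns d ω.1.1 ω.1.2) ω.2
  have hsub : TendstoInMeasure (((columnsLaw K).prod layerLaw).prod (netLaw n)) (Y - X) atTop 0 :=
    tendstoInMeasure_outputTangent_sub hφ hg hd Θ n m
  have h := tendstoInDistribution_of_tendstoInMeasure_sub (X := X) Y _
    (tendstoInDistribution_nextColumns hφ hg _ n m) hsub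
    fun d => (measurable_outputTangent_next hφ n d m _).aemeasurable
  exact h.tendsto.congr fun d => Subtype.ext (tangentLaw_succ hφ n d m K Θ).symm

end GCN

/-! ### The tangent kernel as a forward recursion -/

namespace GCN

variable {V : Type*} [Fintype V] {G : GCN V} {k : ℕ} {m : Fin k → ℕ}

/-- The layer of a parameter. -/
def paramLayer : ParamIdx → ℕ := Sum.elim Prod.fst Prod.fst

variable (G m) in
/-- The parameters of the layer `r + 1`. -/
def layerParams (r : ℕ) : Finset ParamIdx :=
  ({r + 1} ×ˢ Finset.range (G.width m r) ×ˢ Finset.range (G.width m (r + 1))).disjSum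
    ({r + 1} ×ˢ Finset.range (G.width m (r + 1)))

omit [Fintype V] in
lemma sum_layerParams (r : ℕ) (F : ParamIdx → ℝ) :
    ∑ p ∈ G.layerParams m r, F p
      = (∑ j ∈ Finset.range (G.width m r), ∑ i ∈ Finset.range (G.width m (r + 1)),
          F (weight (r + 1) j i)) + ∑ i ∈ Finset.range (G.width m (r + 1)), F (bias (r + 1) i) := by
  simp [layerParams, Finset.sum_disjSum, Finset.sum_product]

omit [Fintype V] in
lemma paramLayer_of_mem {r : ℕ} {p : ParamIdx} (hp : p ∈ G.layerParams m r) :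
    paramLayer p = r + 1 := by
  rcases p with p | p
  · rw [layerParams, Finset.inl_mem_disjSum, Finset.mem_product, Finset.mem_singleton] at hp
    exact hp.1
  · rw [layerParams, Finset.inr_mem_disjSum, Finset.mem_product, Finset.mem_singleton] at hp
    exact hp.1

/-- A parameter of another layer acts on the affine part only through the layer input. -/
lemma affineGrad_of_ne {θ : ParamIdx → ℝ} {p : ParamIdx} {l : ℕ} (hp : paramLayer p ≠ l + 1)
    (h dh : V → ℕ → ℝ) (x : V) (i : ℕ) :
    G.affineGrad m θ p l h dh x i = ∑ v, G.A x v * (G.σw / √(G.width m l : ℝ) *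
      ∑ j ∈ Finset.range (G.width m l), θ (weight (l + 1) j i) * dh v j) := by
  have h1 (j : ℕ) : p ≠ weight (l + 1) j i := by rintro rfl; exact hp rfl
  have h2 : p ≠ bias (l + 1) i := by rintro rfl; exact hp rfl
  simp [affineGrad, h1, h2]

lemma postGrad_eq_zero (θ : ParamIdx → ℝ) {p : ParamIdx} {l : ℕ} (hp : l < paramLayer p) :
    G.postGrad m θ p l = 0 := by
  induction l with
  | zero => rfl
  | succ l ih =>
    ext x i
    simp [postGrad, affineGrad_of_ne hp.ne', ih (by omega)]

lemma affineGrad_weight (θ : ParamIdx → ℝ) (l : ℕ) (h : V → ℕ → ℝ) (x : V) (i i₀ : ℕ) {j : ℕ}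
    (hj : j ∈ Finset.range (G.width m l)) :
    G.affineGrad m θ (weight (l + 1) j i₀) l h 0 x i
      = if i₀ = i then G.σw / √(G.width m l : ℝ) * ∑ v, G.A x v * h v j else 0 := by
  have hj' := Finset.mem_range.1 hj
  by_cases hi : i₀ = i
  · subst hi
    simp [affineGrad, weight, bias, Finset.mul_sum, hj']
    exact Finset.sum_congr rfl fun v _ => by ring
  · simp [affineGrad, weight, bias, hi]

lemma affineGrad_bias (θ : ParamIdx → ℝ) (l : ℕ) (h : V → ℕ → ℝ) (x : V) (i i₀ : ℕ) :
    G.affineGrad m θ (bias (l + 1) i₀) l h 0 x i = if i₀ = i then G.σb else 0 := by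
  by_cases hi : i₀ = i <;> simp [affineGrad, weight, bias, hi]

/-- The contribution of the parameters of a layer to the tangent kernel of its pre-activations. -/
lemma sum_layerParams_affineGrad (θ : ParamIdx → ℝ) (l : ℕ) (h : V → ℕ → ℝ) {i i' : ℕ}
    (hi : i < G.width m (l + 1)) (x x' : V) :
    ∑ p ∈ G.layerParams m l, G.affineGrad m θ p l h 0 x i * G.affineGrad m θ p l h 0 x' i'
      = (if i = i' then G.transport (empiricalMoment (G.width m l) fun j v => h v j) else 0) x x'
    := by
  have hi' := Finset.mem_range.2 hi
  have hc : G.σw / √(G.width m l : ℝ) * (G.σw / √(G.width m l : ℝ))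
      = G.σw ^ 2 / (G.width m l : ℝ) := by
    rw [div_mul_div_comm, Real.mul_self_sqrt (Nat.cast_nonneg _), pow_two]
  rw [sum_layerParams]
  simp only [affineGrad_bias]
  rw [Finset.sum_congr rfl fun j hj => Finset.sum_congr rfl fun i₀ _ => by
    rw [affineGrad_weight θ l h x i i₀ hj, affineGrad_weight θ l h x' i' i₀ hj]]
  by_cases hii : i = i'
  · subst hii
    simp only [if_true, ite_mul, zero_mul, mul_ite, mul_zero, Finset.sum_ite_eq', hi']
    simp only [transport, Matrix.add_apply, Matrix.smul_apply, mul_mul_transpose_apply,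
      empiricalMoment, Matrix.of_apply, smul_eq_mul, mul_one]
    rw [add_comm, ← pow_two]
    congr 1
    simp only [mul_mul_mul_comm (G.σw / _), hc, Finset.sum_mul_sum]
    rw [← Finset.mul_sum, div_mul_eq_mul_div, mul_div_assoc, Finset.sum_div]
    congr 1
    simp only [Finset.sum_div, Finset.mul_sum, Finset.sum_mul]
    rw [Finset.sum_congr rfl fun j _ => Finset.sum_comm, Finset.sum_comm]
    refine Finset.sum_congr rfl fun v' _ => ?_
    rw [Finset.sum_comm]
    exact Finset.sum_congr rfl fun v _ => Finset.sum_congr rfl fun j _ => by ring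
  · have hz (i₀ : ℕ) (a b : ℝ) : (if i₀ = i then a else 0) * (if i₀ = i' then b else 0) = 0 := by
      by_cases h1 : i₀ = i
      · subst h1; simp [hii]
      · simp [h1]
    simp [hz, hii]

/-- The products of linear images of the vectors `g a`, summed over `a`, depend on the products of
their entries only. -/
lemma sum_mul_linear {ι : Type*} (s : Finset ι) (A : Matrix V V ℝ) (x x' : V) (c : ℝ) (d : ℕ)
    (w w' : ℕ → ℝ) (e : V → ℕ → ℝ) (g : ι → V → ℕ → ℝ) :
    ∑ a ∈ s, (∑ v, A x v * (c * ∑ j ∈ Finset.range d, w j * (e v j * g a v j)))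
        * (∑ v, A x' v * (c * ∑ j ∈ Finset.range d, w' j * (e v j * g a v j)))
      = ∑ v', ∑ v, A x v * (c * c * ∑ j ∈ Finset.range d, ∑ j' ∈ Finset.range d,
          e v j * e v' j' * (∑ a ∈ s, g a v j * g a v' j') * (w j * w' j')) * A x' v' := by
  simp only [Finset.sum_mul_sum]
  rw [Finset.sum_comm, Finset.sum_congr rfl fun v _ => Finset.sum_comm, Finset.sum_comm]
  refine Finset.sum_congr rfl fun v' _ => Finset.sum_congr rfl fun v _ => ?_
  have h : ∑ j ∈ Finset.range d, ∑ j' ∈ Finset.range d,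
        e v j * e v' j' * (∑ a ∈ s, g a v j * g a v' j') * (w j * w' j')
      = ∑ a ∈ s, (∑ j ∈ Finset.range d, w j * (e v j * g a v j))
        * ∑ j ∈ Finset.range d, w' j * (e v' j * g a v' j) := by
    simp only [Finset.sum_mul_sum]
    simp only [Finset.mul_sum, Finset.sum_mul]
    rw [Finset.sum_congr rfl fun j _ => Finset.sum_comm, Finset.sum_comm]
    exact Finset.sum_congr rfl fun a _ => Finset.sum_congr rfl fun j _ =>
      Finset.sum_congr rfl fun j' _ => by ring
  rw [h, Finset.mul_sum, Finset.mul_sum, Finset.sum_mul]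
  exact Finset.sum_congr rfl fun a _ => by ring

/-- The parameters of layer `l`, arranged by columns: each column has its bias (`none`) and its
weights. -/
def paramColumn (θ : ParamIdx → ℝ) (l i : ℕ) : Option ℕ → ℝ
  | none => θ (bias l i)
  | some j => θ (weight l j i)

variable (G m) in
/-- The columns of the pre-activations of layer `l + 1`. -/
noncomputable def preColumn (θ : ParamIdx → ℝ) (l i : ℕ) : EuclideanSpace ℝ V :=
  G.column (G.width m l) (fun j v => G.postAct m θ l v j) (paramColumn θ (l + 1) i)

variable (G m) in
/-- The tangent kernel of the pre-activations of layer `l + 1`, between the columns `i` and `i'`. -/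
noncomputable def layerTangent (θ : ParamIdx → ℝ) (l i i' : ℕ) : Matrix V V ℝ :=
  Matrix.of fun x x' => ∑ r ∈ Finset.range (l + 1), ∑ p ∈ G.layerParams m r,
    G.affineGrad m θ p l (G.postAct m θ l) (G.postGrad m θ p l) x i
      * G.affineGrad m θ p l (G.postAct m θ l) (G.postGrad m θ p l) x' i'

lemma layerTangent_zero (θ : ParamIdx → ℝ) {i : ℕ} (hi : i < G.width m 1) (i' : ℕ) :
    G.layerTangent m θ 0 i i'
      = if i = i' then G.transport (empiricalMoment G.inDim fun j v => G.input v j) else 0 := by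
  ext x x'
  have h := sum_layerParams_affineGrad θ 0 G.input (i' := i') hi x x'
  simp only [layerTangent, Matrix.of_apply, zero_add, Finset.sum_range_one]
  exact h

lemma layerTangent_succ (θ : ParamIdx → ℝ) (l : ℕ) {M : ℕ → ℕ → Matrix V V ℝ}
    (hM : ∀ i < G.width m (l + 1), ∀ i' < G.width m (l + 1), M i i' = G.layerTangent m θ l i i')
    {i i' : ℕ} (hi : i < G.width m (l + 2)) :
    G.nextTangent (G.width m (l + 1)) (G.preColumn m θ l) M (paramColumn θ (l + 2)) i i'
      = G.layerTangent m θ (l + 1) i i' := by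
  ext x x'
  have hc : G.σw / √(G.width m (l + 1) : ℝ) * (G.σw / √(G.width m (l + 1) : ℝ))
      = G.σw ^ 2 / (G.width m (l + 1) : ℝ) := by
    rw [div_mul_div_comm, Real.mul_self_sqrt (Nat.cast_nonneg _), pow_two]
  simp only [nextTangent, layerTangent, Matrix.of_apply, Matrix.add_apply, Matrix.smul_apply,
    smul_eq_mul]
  rw [Finset.sum_range_succ, add_comm]
  congr 1
  -- the parameters of the layers below act through the layer input
  · have hlow : ∀ r ∈ Finset.range (l + 1), ∀ p ∈ G.layerParams m r, ∀ x i,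
        G.affineGrad m θ p (l + 1) (G.postAct m θ (l + 1)) (G.postGrad m θ p (l + 1)) x i
          = ∑ v, G.A x v * (G.σw / √(G.width m (l + 1) : ℝ) *
            ∑ j ∈ Finset.range (G.width m (l + 1)), paramColumn θ (l + 2) i (some j) *
              (deriv G.φ (G.preColumn m θ l j v) *
                G.affineGrad m θ p l (G.postAct m θ l) (G.postGrad m θ p l) v j)) := by
      intro r hr p hp x i
      have h1 := paramLayer_of_mem hp
      have h2 := Finset.mem_range.1 hr
      exact affineGrad_of_ne (by omega) _ _ x i
    rw [Finset.sum_congr rfl fun r hr => Finset.sum_congr rfl fun p hp => by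
      rw [hlow r hr p hp x i, hlow r hr p hp x' i'], Finset.sum_sigma', sum_mul_linear, hc,
      mul_mul_transpose_apply, Finset.mul_sum]
    refine Finset.sum_congr rfl fun v' _ => ?_
    rw [Finset.mul_sum]
    refine Finset.sum_congr rfl fun v _ => ?_
    have hs : ∑ j ∈ Finset.range (G.width m (l + 1)), ∑ j' ∈ Finset.range (G.width m (l + 1)),
          deriv G.φ (G.preColumn m θ l j v) * deriv G.φ (G.preColumn m θ l j' v') * M j j' v v' *
            (paramColumn θ (l + 2) i (some j) * paramColumn θ (l + 2) i' (some j'))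
        = ∑ j ∈ Finset.range (G.width m (l + 1)), ∑ j' ∈ Finset.range (G.width m (l + 1)),
          deriv G.φ (G.preColumn m θ l j v) * deriv G.φ (G.preColumn m θ l j' v') *
            (∑ a ∈ (Finset.range (l + 1)).sigma fun r => G.layerParams m r,
              G.affineGrad m θ a.2 l (G.postAct m θ l) (G.postGrad m θ a.2 l) v j *
              G.affineGrad m θ a.2 l (G.postAct m θ l) (G.postGrad m θ a.2 l) v' j') *
            (paramColumn θ (l + 2) i (some j) * paramColumn θ (l + 2) i' (some j')) :=
      Finset.sum_congr rfl fun j hj => Finset.sum_congr rfl fun j' hj' => by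
        rw [hM j (Finset.mem_range.1 hj) j' (Finset.mem_range.1 hj'), layerTangent,
          Matrix.of_apply, Finset.sum_sigma']
    rw [Matrix.of_apply, hs]
    ring
  -- the parameters of the layer itself do not affect its input
  · have hz : ∀ p ∈ G.layerParams m (l + 1), G.postGrad m θ p (l + 1) = 0 := fun p hp =>
      postGrad_eq_zero θ (by rw [paramLayer_of_mem hp]; omega)
    rw [Finset.sum_congr rfl fun p hp => by rw [hz p hp], sum_layerParams_affineGrad θ _ _ hi]
    rfl

/-- The sum over all parameters is the forward recursion. -/
lemma outputTangent_eq_layerTangent (θ : ParamIdx → ℝ) (n l : ℕ) (hl : l + n = k)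
    {m' : Fin n → ℕ} (hm' : ∀ i : Fin n, m' i = G.width m (l + 1 + i))
    {θ' : Fin n → ℕ → Option ℕ → ℝ} (hθ' : ∀ i : Fin n, θ' i = paramColumn θ (l + 2 + i))
    {M : ℕ → ℕ → Matrix V V ℝ}
    (hM : ∀ i < G.width m (l + 1), ∀ i' < G.width m (l + 1), M i i' = G.layerTangent m θ l i i') :
    G.outputTangent n m' M (G.preColumn m θ l) θ' = G.layerTangent m θ k 0 0 := by
  induction n generalizing l M with
  | zero =>
    obtain rfl : l = k := hl
    have h0 : 0 < G.width m (l + 1) := by simp [width]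
    rw [← hM 0 h0 0 h0]
    rfl
  | succ n ih =>
    have e1 : m' 0 = G.width m (l + 1) := hm' 0
    have e2 : θ' 0 = paramColumn θ (l + 2) := hθ' 0
    simp only [outputTangent, e1, e2]
    refine ih (l + 1) (by omega) (fun i => ?_) (fun i => ?_) (M := _) fun i hi i' _ => ?_
    · rw [Fin.tail, hm' i.succ, Fin.val_succ]
      congr 1
      omega
    · rw [Fin.tail, hθ' i.succ, Fin.val_succ]
      congr 1
      omega
    · exact layerTangent_succ θ l hM hi

lemma empiricalMoment_input [DecidableEq V] :
    empiricalMoment G.inDim (fun j v => G.input v j) = G.C 0 := by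
  ext v v'
  simp only [empiricalMoment, Matrix.of_apply, C, Matrix.smul_apply, Matrix.mul_apply,
    Matrix.transpose_apply, smul_eq_mul, Finset.sum_range, input, Fin.is_lt, dite_true, Fin.eta]
  ring

/-- Almost surely, the neural tangent kernel is given by the forward recursion. -/
lemma ae_ntk_eq_outputTangent [DecidableEq V] (m : Fin k → ℕ) (hφ : LocallyLipschitz G.φ)
    (hφ' : {t : ℝ | ¬ ContDiffAt ℝ 1 G.φ t}.Countable) :
    ∀ᵐ θ ∂(Measure.infinitePi fun _ : ParamIdx => gaussianReal 0 1),
      G.ntk m θ = G.outputTangent k m (diagonalKernel (G.transport (G.C 0)))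
        (G.preColumn m θ 0) (fun i => paramColumn θ (i + 2)) := by
  filter_upwards [ae_gradOutput_eq m hφ hφ'] with θ hθ
  rw [outputTangent_eq_layerTangent θ k 0 (zero_add k) (fun i => ?_) (fun i => ?_)
    fun i hi i' _ => ?_]
  · ext x x'
    simp only [ntk, hθ, layerTangent, Matrix.of_apply, sum_layerParams]
  · simp [width, add_comm 1]
  · rw [zero_add, add_comm]
  · rw [layerTangent_zero θ hi, empiricalMoment_input]
    rfl

end GCN

/-! ### The law of the parameters and the iterated limit -/

namespace GCN

/-- The law of the standard normal parameters. -/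
noncomputable def paramLaw : Measure (ParamIdx → ℝ) := Measure.infinitePi fun _ => gaussianReal 0 1

/-- The parameters of the layers `1, …, n`, arranged by columns, are independent. -/
lemma map_paramLaw_paramColumn (n : ℕ) :
    paramLaw.map (fun θ (i : Fin n) => paramColumn θ (i + 1)) = netLaw n := by
  -- the product over all names is restricted to the names in use, and then curried twice
  have hf : Function.Injective fun a : Fin n × ℕ × Option ℕ =>
      a.2.2.elim (bias (a.1 + 1) a.2.1) fun j => weight (a.1 + 1) j a.2.1 := by
    rintro ⟨l, i, _ | j⟩ ⟨l', i', _ | j'⟩ h <;> simp [weight, bias, Fin.ext_iff] at h ⊢ <;> tauto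
  have h1 := Measure.map_infinitePi_infinitePi_of_inj
    (P := fun _ : ParamIdx => gaussianReal 0 1) hf
  have h2 := Measure.infinitePi_map_curry fun (_ : Fin n) (_ : ℕ × Option ℕ) => gaussianReal 0 1
  have h3 := Measure.infinitePi_map_curry fun (_ : ℕ) (_ : Option ℕ) => gaussianReal 0 1
  have h4 := Measure.infinitePi_map_pi
    (fun _ : Fin n => Measure.infinitePi fun _ : ℕ × Option ℕ => gaussianReal 0 1)
    (fun _ => (MeasurableEquiv.curry ℕ (Option ℕ) ℝ).measurable)
  rw [h3] at h4
  have e : netLaw n = Measure.infinitePi fun _ : Fin n =>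
      Measure.infinitePi fun _ : ℕ => Measure.infinitePi fun _ : Option ℕ => gaussianReal 0 1 := by
    rw [Measure.infinitePi_eq_pi]
    rfl
  have m1 : Measurable fun (y : Fin n → ℕ × Option ℕ → ℝ) (i : Fin n) =>
      MeasurableEquiv.curry ℕ (Option ℕ) ℝ (y i) := by fun_prop
  have m3 : Measurable fun (θ : ParamIdx → ℝ) (a : Fin n × ℕ × Option ℕ) =>
      θ (a.2.2.elim (bias (a.1 + 1) a.2.1) fun j => weight (a.1 + 1) j a.2.1) := by fun_prop
  rw [e, ← h4, ← h2, ← h1, Measure.map_map (MeasurableEquiv.measurable _) m3,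
    Measure.map_map m1 ((MeasurableEquiv.measurable _).comp m3)]
  unfold paramLaw
  congr 1
  funext θ l i o
  cases o <;> rfl

variable {V : Type*} [Fintype V] [DecidableEq V] {G : GCN V} {k : ℕ}

lemma map_layerLaw_columnsLaw (d : ℕ) (h : ℕ → V → ℝ) :
    layerLaw.map (fun W i => G.column d h (W i))
      = columnsLaw (G.transport (empiricalMoment d h)) := by
  have hm : Measurable (G.column d h) := measurable_column d (fun _ _ => measurable_const)
    measurable_id
  have h2 := Measure.infinitePi_map_pi (fun _ : ℕ => colLaw) (fun _ => hm)
  rw [map_column_colLaw] at h2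
  exact h2

/-- The first pre-activations are exactly Gaussian, and independent of the parameters of the other
layers. -/
lemma map_paramLaw_preColumn (m : Fin k → ℕ) :
    paramLaw.map (fun θ => (G.preColumn m θ 0, fun i : Fin k => paramColumn θ (i + 2)))
      = (columnsLaw (G.K 1)).prod (netLaw k) := by
  have h1 : MeasurePreserving (MeasurableEquiv.piFinSuccAbove (fun _ => ℕ → Option ℕ → ℝ) 0)
      (netLaw (k + 1)) (layerLaw.prod (netLaw k)) :=
    measurePreserving_piFinSuccAbove (fun _ : Fin (k + 1) => layerLaw) 0
  have mc : Measurable fun (W : ℕ → Option ℕ → ℝ) (i : ℕ) =>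
      G.column G.inDim (fun j v => G.input v j) (W i) :=
    measurable_pi_lambda _ fun i => measurable_column _ (fun _ _ => measurable_const)
      (measurable_pi_apply _)
  have h2 : MeasurePreserving (fun (W : ℕ → Option ℕ → ℝ) (i : ℕ) =>
      G.column G.inDim (fun j v => G.input v j) (W i)) layerLaw (columnsLaw (G.K 1)) :=
    ⟨mc, by rw [map_layerLaw_columnsLaw, empiricalMoment_input]; rfl⟩
  have m0 : Measurable fun (θ : ParamIdx → ℝ) (i : Fin (k + 1)) => paramColumn θ (i + 1) := by
    refine measurable_pi_lambda _ fun l => measurable_pi_lambda _ fun i =>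
      measurable_pi_lambda _ fun o => ?_
    cases o <;> exact measurable_pi_apply _
  have h3 := ((h2.prod (MeasurePreserving.id (netLaw k))).comp h1).comp
    (⟨m0, map_paramLaw_paramColumn (k + 1)⟩ : MeasurePreserving _ paramLaw (netLaw (k + 1)))
  rw [← h3.map_eq]
  rfl

/-- The law of the neural tangent kernel at standard normal parameters. -/
lemma map_paramLaw_ntk (m : Fin k → ℕ) (hφ : LocallyLipschitz G.φ)
    (hφ' : {t : ℝ | ¬ ContDiffAt ℝ 1 G.φ t}.Countable) :
    paramLaw.map (G.ntk m)
      = tangentLaw G hφ.continuous.measurable k m (G.K 1) (G.Theta 1) := by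
  have mp : Measurable fun θ : ParamIdx → ℝ =>
      (G.preColumn m θ 0, fun i : Fin k => paramColumn θ (i + 2)) := by
    have mcol (l i : ℕ) : Measurable fun θ : ParamIdx → ℝ => paramColumn θ l i := by
      refine measurable_pi_lambda _ fun o => ?_
      cases o <;> exact measurable_pi_apply _
    refine Measurable.prodMk (measurable_pi_lambda _ fun i =>
      measurable_column _ (fun _ _ => measurable_const) (mcol 1 i)) ?_
    exact measurable_pi_lambda _ fun l => measurable_pi_lambda _ fun i => mcol _ i
  have e : G.Theta 1 = G.transport (G.C 0) := by simp [Theta]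
  calc paramLaw.map (G.ntk m)
      = paramLaw.map ((fun p : (ℕ → EuclideanSpace ℝ V) × (Fin k → ℕ → Option ℕ → ℝ) =>
          G.outputTangent k m (diagonalKernel (G.Theta 1)) p.1 p.2) ∘ fun θ =>
          (G.preColumn m θ 0, fun i : Fin k => paramColumn θ (i + 2))) := by
        refine Measure.map_congr ?_
        rw [e]
        exact ae_ntk_eq_outputTangent m hφ hφ'
    _ = _ := by
        rw [← Measure.map_map (measurable_outputTangent_const hφ.continuous.measurable k m _) mp,
          map_paramLaw_preColumn]
        rfl

/-- Once all layers up to `l` are infinitely wide, the remaining widths may be sent to infinity one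
after the other. -/
lemma seqTendsto_tangentLaw (hφ : Measurable G.φ)
    (hC : ∀ l : ℕ, 1 ≤ l → l ≤ k → ∀ x : V,
      MemLp (fun z : EuclideanSpace ℝ V => G.φ (z x)) 2 (multivariateGaussian 0 (G.K l)))
    (hdotC : ∀ l : ℕ, 1 ≤ l → l ≤ k → ∀ x : V,
      MemLp (fun z : EuclideanSpace ℝ V => deriv G.φ (z x)) 2 (multivariateGaussian 0 (G.K l)))
    (n l : ℕ) (hl : l + n = k) :
    SeqTendsto n (fun m => tangentLaw G hφ n m (G.K (l + 1)) (G.Theta (l + 1)))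
      (diracProba fun x x' : V => G.Theta (k + 1) x x') := by
  induction n generalizing l with
  | zero =>
    obtain rfl : l = k := hl
    apply Subtype.ext
    have h : (fun p : (ℕ → EuclideanSpace ℝ V) × (Fin 0 → ℕ → Option ℕ → ℝ) =>
        G.outputTangent 0 ![] (diagonalKernel (G.Theta (l + 1))) p.1 p.2)
        = fun _ => fun x x' => G.Theta (l + 1) x x' := by
      funext p x x'
      simp [outputTangent, diagonalKernel]
    change ((columnsLaw (G.K (l + 1))).prod (netLaw 0)).map (fun p =>
      G.outputTangent 0 ![] (diagonalKernel (G.Theta (l + 1))) p.1 p.2) = _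
    rw [h, Measure.map_const, measure_univ, one_smul]
    rfl
  | succ n ih =>
    exact ⟨_, fun m => tendsto_tangentLaw hφ (hC (l + 1) (by omega) (by omega))
      (hdotC (l + 1) (by omega) (by omega)) (G.Theta (l + 1)) n m, ih (l + 1) (by omega)⟩

end GCN

/-- Here `L = k + 1` is the number of layers, and the law of the neural tangent kernel at the random
parameters `θ` converges weakly to the point mass at the deterministic matrix `Θ⁽ᴸ⁾`
when the hidden widths `d₁, …, dₖ` tend to infinity in succession. -/
theorem theorem2 {V : Type*} [Fintype V] [DecidableEq V] (G : GCN V) (k : ℕ)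
    -- the activation is locally Lipschitz and continuously differentiable off a countable set
    (hφ : LocallyLipschitz G.φ)
    (hφ' : {t : ℝ | ¬ ContDiffAt ℝ 1 G.φ t}.Countable)
    -- the Gaussian second moments in the recursion are finite
    (hC : ∀ l : ℕ, 1 ≤ l → l ≤ k → ∀ x : V,
      MeasureTheory.MemLp (fun z : EuclideanSpace ℝ V => G.φ (z x)) 2
        (ProbabilityTheory.multivariateGaussian 0 (G.K l)))
    (hdotC : ∀ l : ℕ, 1 ≤ l → l ≤ k → ∀ x : V,
      MeasureTheory.MemLp (fun z : EuclideanSpace ℝ V => deriv G.φ (z x)) 2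
        (ProbabilityTheory.multivariateGaussian 0 (G.K l)))
    -- the weights and biases are independent standard normal
    {Ω : Type*} [MeasurableSpace Ω] (P : MeasureTheory.ProbabilityMeasure Ω)
    (θ : GCN.ParamIdx → Ω → ℝ)
    (hindep : ProbabilityTheory.iIndepFun θ (P : MeasureTheory.Measure Ω))
    (hlaw : ∀ p : GCN.ParamIdx, ProbabilityTheory.HasLaw (θ p)
      (ProbabilityTheory.gaussianReal 0 1) (P : MeasureTheory.Measure Ω)) :
    ∃ hmeas : ∀ m : Fin k → ℕ,
        AEMeasurable (fun ω => G.ntk m (fun p => θ p ω)) (P : MeasureTheory.Measure Ω),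
      SeqTendsto k (fun m : Fin k → ℕ => P.map (hmeas m))
        (MeasureTheory.diracProba (fun x x' : V => G.Theta (k + 1) x x')) := by
  have mθ : AEMeasurable (fun ω p => θ p ω) (P : Measure Ω) :=
    aemeasurable_pi_iff.2 fun p => (hlaw p).aemeasurable
  have hθ : (P : Measure Ω).map (fun ω p => θ p ω) = GCN.paramLaw := by
    rw [hindep.map_fun_eq_infinitePi_map₀ mθ]
    simp_rw [fun p => (hlaw p).map_eq]
    rfl
  have mn (m : Fin k → ℕ) : Measurable (G.ntk m) := GCN.measurable_ntk m hφ.continuous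
  refine ⟨fun m => (mn m).comp_aemeasurable mθ, ?_⟩
  have h : (fun m : Fin k → ℕ => P.map ((mn m).comp_aemeasurable mθ))
      = fun m => GCN.tangentLaw G hφ.continuous.measurable k m (G.K 1) (G.Theta 1) := by
    funext m
    refine Subtype.ext (Eq.trans ?_ (GCN.map_paramLaw_ntk m hφ hφ'))
    rw [← hθ, AEMeasurable.map_map_of_aemeasurable (mn m).aemeasurable mθ]
    rfl
  have h' := GCN.seqTendsto_tangentLaw hφ.continuous.measurable hC hdotC k 0 (zero_add k)
  rw [zero_add, ← h] at h'
  exact h'
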